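/- Let $(m,\sigma,\tau)$ be an origami datum: $m\ge 1$ is an integer and $\sigma,\tau$ are permutations of $\{1,\dots,m\}$ generating a transitive group. Let $\Sigma$ be the associated origami (square-tiled) surface, obtained from $m$ copies $P_1,\dots,P_m$ of $[0,1]^2$ by gluing, by translations and for every $i$, the left side of $P_i$ to the right side of $P_{\sigma(i)}$ and the top side of $P_i$ to the bottom side of $P_{\tau(i)}$ (so $\Sigma$ is an arbitrary origami surface, of any genus $g\ge 1$). Equip $\Sigma$ with the quotient topology, with the area measure $\mu$ (Lebesgue measure on each square, total mass $m$), with its flat path metric, and with the branched covering $\rho\colon\Sigma\to\mathbb{T}^2=\mathbb{R}^2/\mathbb{Z}^2$ induced by the identifications $P_i\cong[0,1]^2$. For every $i$ let $h_i\colon\mathbb{R}\times[0,1]\to\Sigma$ and $v_i\colon[0,1]\times\mathbb{R}\to\Sigma$ be the horizontal and vertical arrangement maps: for $j\in\mathbb{Z}$, $h_i$ maps $[j,j+1]\times[0,1]$ by translation onto $P_{\sigma^{-j}(i)}$, and $v_i$ maps $[0,1]\times[j,j+1]$ by translation onto $P_{\tau^{j}(i)}$. Let $k\ge 2$ be a common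 multiple of the orders of $\sigma$ and $\tau$, and let $a_k=\begin{pmatrix}1&k\\0&1\end{pmatrix}$, $b_k=\begin{pmatrix}1&0\\k&1\end{pmatrix}$. Then $a_k,b_k$ freely generate a free group $\mathbb{F}_2=\langle a_k,b_k\rangle\le \mathrm{SL}_2(\mathbb{Z})$, and there is an action of $\mathbb{F}_2$ on $\Sigma$ by homeomorphisms in which, on each square $P_i\cong[0,1]^2$, $a_k$ acts by $(x,y)\mapsto h_i(x+ky,\,y)$ and $b_k$ acts by $(x,y)\mapsto v_i(x,\,kx+y)$. This action has the following properties. 1. Every $g\in\mathbb{F}_2$ preserves $\mu$, is Lipschitz, lifts the linear action on the torus, i.e. $\rho(g.x)=g\,\rho(x)$, and is affine with linear part $g$, i.e. in translation charts of $\Sigma$ (local lifts of $\rho$ to $\mathbb{R}^2$ that are homeomorphisms between open sets) it is locally of the form $v\mapsto gv+c$. 2. The action is expanding in measure: for every finite symmetric generating set $S\ni 1$ of $\mathbb{F}_2$ there is $c>0$ such that $\mu\big(\bigcup_{s\in S}s.U\big)\ge(1+c)\,\mu(U)$ for every measurable $U\subseteq\Sigma$ with $0<\mu(U)\le\frac12\mu(\Sigma)$.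 3. Equivalently, the action has spectral gap: for every such $S$ there is $\kappa>0$ such that $\sum_{s\in S}\|s.f-f\|_2\ge\kappa\|f\|_2$ for every $f\in L^2(\Sigma,\mu/m)$ with $\int f\,d\mu=0$, where $(s.f)(x)=f(s^{-1}.x)$. -/

import Mathlib

open MeasureTheory Topology
open scoped ENNReal NNReal

noncomputable section

/-! ## Finitely generated groups acting on measure spaces -/

/-- `S` is a finite symmetric generating set of `G` containing the identity. -/
def IsSymmGenSet {G : Type*} [Group G] (S : Finset G) : Prop :=
  1 ∈ S ∧ (∀ s ∈ S, s⁻¹ ∈ S) ∧ Subgroup.closure (S : Set G) = ⊤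

/-- Expansion in measure, with respect to `S`, of an action `φ` of `G` on `(X, μ)`: there is `c > 0`
with `μ (S U) ≥ (1 + c) μ U` for all measurable `U` with `μ U < ∞` and `0 < μ U ≤ μ X / 2`. -/
def MeasureExpanding {G X : Type*} [Group G] [TopologicalSpace X] [MeasurableSpace X]
    (S : Finset G) (φ : G →* (X ≃ₜ X)) (μ : Measure X) : Prop :=
  ∃ c : ℝ, 0 < c ∧ ∀ U : Set X, MeasurableSet U → μ U ≠ ∞ → 0 < μ U →
    μ U ≤ 2⁻¹ * μ Set.univ →
      (1 + ENNReal.ofReal c) * μ U ≤ μ (⋃ s ∈ S, φ s '' U)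

/-- Spectral gap, with respect to `S`, of an action `φ` of `G` on a probability space `(X, μ)`:
there is `κ > 0` with `∑ s ∈ S, ‖s.f - f‖₂ ≥ κ ‖f‖₂` for all `f ∈ L²(X, μ)` of mean zero,
where `(s.f) x = f (s⁻¹ x)`. -/
def HasSpectralGap {G X : Type*} [Group G] [TopologicalSpace X] [MeasurableSpace X]
    (S : Finset G) (φ : G →* (X ≃ₜ X)) (μ : Measure X) : Prop :=
  ∃ κ : ℝ, 0 < κ ∧ ∀ f : X → ℂ, MemLp f 2 μ → ∫ x, f x ∂μ = 0 →
    ENNReal.ofReal κ * eLpNorm f 2 μ ≤ ∑ s ∈ S, eLpNorm (fun x => f (φ s⁻¹ x) - f x) 2 μ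

/-! ## The torus and the matrices `a_k`, `b_k` -/

/-- The torus `ℝ² / ℤ²`. -/
abbrev Torus : Type := UnitAddCircle × UnitAddCircle

/-- The quotient map `ℝ² → ℝ² / ℤ²`. -/
def torusProj (v : ℝ × ℝ) : Torus := (v.1, v.2)

/-- The linear action of an integer matrix on `ℝ²`. -/
def planeAct (A : Matrix.SpecialLinearGroup (Fin 2) ℤ) (v : ℝ × ℝ) : ℝ × ℝ :=
  (A 0 0 * v.1 + A 0 1 * v.2, A 1 0 * v.1 + A 1 1 * v.2)

/-- The induced action on the torus. -/
def torusAct (A : Matrix.SpecialLinearGroup (Fin 2) ℤ) (z : Torus) : Torus :=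
  (A 0 0 • z.1 + A 0 1 • z.2, A 1 0 • z.1 + A 1 1 • z.2)

/-- `a_k = (1 k; 0 1)`. -/
def matA (k : ℕ) : Matrix.SpecialLinearGroup (Fin 2) ℤ :=
  ⟨!![1, (k : ℤ); 0, 1], by simp [Matrix.det_fin_two]⟩

/-- `b_k = (1 0; k 1)`. -/
def matB (k : ℕ) : Matrix.SpecialLinearGroup (Fin 2) ℤ :=
  ⟨!![1, 0; (k : ℤ), 1], by simp [Matrix.det_fin_two]⟩

/-- The homomorphism from the free group of rank two, with free generators indexed by `0` and `1`,
sending these generators to `a_k` and `b_k`; its range is `⟨a_k, b_k⟩`. -/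
def freeToSL (k : ℕ) : FreeGroup (Fin 2) →* Matrix.SpecialLinearGroup (Fin 2) ℤ :=
  FreeGroup.lift ![matA k, matB k]

/-! ## Origami surfaces -/

/-- An origami datum `(m, σ, τ)`. -/
structure OrigamiDatum where
  m : ℕ
  m_pos : 0 < m
  σ : Equiv.Perm (Fin m)
  τ : Equiv.Perm (Fin m)
  transitive : ∀ i j : Fin m, ∃ g ∈ Subgroup.closure {σ, τ}, g i = j

namespace OrigamiDatum

variable (D : OrigamiDatum)

/-- The gluings of the squares `{i} × [0,1]²`: the left side of square `i` is glued to the right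
side of square `σ i`, and the top side of square `i` to the bottom side of square `τ i`,
by translations. -/
inductive Glue : Fin D.m × (unitInterval × unitInterval) → Fin D.m × (unitInterval × unitInterval) → Prop
  | horizontal (i : Fin D.m) (y : unitInterval) : Glue (i, (0, y)) (D.σ i, (1, y))
  | vertical (i : Fin D.m) (x : unitInterval) : Glue (i, (x, 1)) (D.τ i, (x, 0))

/-- The origami surface, with the quotient topology. -/
def Surface : Type := Quot D.Glue

instance : TopologicalSpace D.Surface := inferInstanceAs (TopologicalSpace (Quot D.Glue))

instance : MeasurableSpace D.Surface := borel D.Surface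

instance : BorelSpace D.Surface := ⟨rfl⟩

/-- The point of the surface given by the point `p` of the square `i`. -/
def pt (i : Fin D.m) (p : unitInterval × unitInterval) : D.Surface := Quot.mk D.Glue (i, p)

/-- The area measure on the surface (of total mass `m`): the sum over all squares of
Lebesgue measure on the square. -/
def area : Measure D.Surface :=
  Measure.sum fun i : Fin D.m =>
    Measure.map (D.pt i) (volume : Measure (unitInterval × unitInterval))

/-- The normalised area measure (of total mass one). -/
def normArea : Measure D.Surface := (D.m : ℝ≥0∞)⁻¹ • D.area

/-- The map `ρ` from the surface to the torus. -/
def toTorus : D.Surface → Torus :=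
  Quot.lift (fun q => torusProj ((q.2.1 : ℝ), (q.2.2 : ℝ))) (by
    have h : ((1 : ℝ) : UnitAddCircle) = 0 := AddCircle.coe_period (1 : ℝ)
    rintro _ _ (⟨i, y⟩ | ⟨i, x⟩) <;> simp [torusProj, h])

/-- Euclidean distance of two points of the unit square. -/
def squareDist (p q : unitInterval × unitInterval) : ℝ :=
  √(((p.1 : ℝ) - q.1) ^ 2 + ((p.2 : ℝ) - q.2) ^ 2)

/-- `ChainLength x y ℓ`: there is a polygonal path of length `ℓ` from `x` to `y`, that is, a
concatenation of finitely many straight segments each of which lies in one square. -/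
inductive ChainLength : D.Surface → D.Surface → ℝ → Prop
  | nil (x : D.Surface) : ChainLength x x 0
  | cons (i : Fin D.m) (p q : unitInterval × unitInterval) (y : D.Surface) (ℓ : ℝ) :
      ChainLength (D.pt i q) y ℓ → ChainLength (D.pt i p) y (squareDist p q + ℓ)

/-- The flat metric of the surface: the infimum of the lengths of polygonal paths. -/
def flatDist (x y : D.Surface) : ℝ≥0∞ :=
  ⨅ (ℓ : ℝ) (_ : D.ChainLength x y ℓ), ENNReal.ofReal ℓ

/-- The horizontal arrangement map `h_i : ℝ × [0,1] → Σ`: it maps `[j, j+1] × [0,1]` by a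
translation onto the square `σ ^ (-j) i` (recall that the right neighbour of a square `i` is
the square `σ⁻¹ i`). -/
def horArr (i : Fin D.m) (x : ℝ) (y : unitInterval) : D.Surface :=
  D.pt ((D.σ ^ (-⌊x⌋)) i) (⟨Int.fract x, Int.fract_nonneg x, (Int.fract_lt_one x).le⟩, y)

/-- The vertical arrangement map `v_i : [0,1] × ℝ → Σ`: it maps `[0,1] × [j, j+1]` by a
translation onto the square `τ ^ j i`. -/
def verArr (i : Fin D.m) (x : unitInterval) (y : ℝ) : D.Surface :=
  D.pt ((D.τ ^ ⌊y⌋) i) (x, ⟨Int.fract y, Int.fract_nonneg y, (Int.fract_lt_one y).le⟩)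

/-- `φ` is the origami action with parameter `k`: on every square `i`, the first generator acts
by `h_i ∘ a_k` and the second one by `v_i ∘ b_k`. -/
def IsOrigamiAction (k : ℕ) (φ : FreeGroup (Fin 2) →* (D.Surface ≃ₜ D.Surface)) : Prop :=
  ∀ (i : Fin D.m) (x y : unitInterval),
    φ (FreeGroup.of 0) (D.pt i (x, y)) = D.horArr i (x + k * y) y ∧
    φ (FreeGroup.of 1) (D.pt i (x, y)) = D.verArr i x (k * x + y)

/-- The charts of the translation structure: homeomorphisms from open subsets of the surface onto
open subsets of the plane which locally lift `ρ`. (They cover the surface except for the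
points at which `ρ` is ramified.) -/
def IsTranslationChart (e : OpenPartialHomeomorph D.Surface (ℝ × ℝ)) : Prop :=
  ∀ y ∈ e.source, torusProj (e y) = D.toTorus y

/-- `f` is affine with linear part `A`: in translation charts it is locally `v ↦ A v + c`. -/
def IsAffineWith (f : D.Surface ≃ₜ D.Surface) (A : Matrix.SpecialLinearGroup (Fin 2) ℤ) : Prop :=
  ∀ e e' : OpenPartialHomeomorph D.Surface (ℝ × ℝ),
    D.IsTranslationChart e → D.IsTranslationChart e' →
    ∀ x ∈ e.source, f x ∈ e'.source →
      ∃ c : ℝ × ℝ, ∀ᶠ y in 𝓝 x, e' (f y) = planeAct A (e y) + c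

end OrigamiDatum

end

/-!
Freeness of `⟨a_k, b_k⟩` is the ping-pong lemma for the action on slopes. Since `σ^k = τ^k = 1`, the
shears by `a_k` and `b_k` on the squares respect the gluings, and the free group acts on the surface
through them. These shears cover the linear maps of the torus. Together with the continuity of
charts this makes the whole action affine (`isAffineWith_of_toTorus`), and, as the surface is a
finite cover of the torus by copies of the square, measure preserving.

The main point is spectral gap, which is proved in three steps.

* *Torus* (`torus_spectral_gap`). On Fourier coefficients, `a_k` and `b_k` act by unipotent matrices
  on `ℤ²`. Each cone `|p| < |q|` and `|q| < |p|` contains two disjoint images of the other one, so a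
  square-summable function which is almost invariant has little mass outside the origin.

* *Ergodicity* (`ae_eq_const_of_invariant`). On almost every horizontal line of the surface the
  shear is an irrational rotation of a circle of length `k`. An invariant function is therefore
  constant on almost every horizontal line through two neighbouring squares, and likewise on
  vertical lines. By transitivity of `⟨σ, τ⟩` it is constant.

* *Finite covers* (`IsFiniteCover.exists_gap`). The absence of a gap on the `m`-fold cover, away from
  the invariant functions, would yield `m + 1` almost orthonormal and almost invariant functions.
  Their fibrewise inner products are almost invariant functions on the torus, hence almost
  constant by the gap there, which would give `m + 1` almost orthonormal vectors in `ℝ^m`.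
  With ergodicity, the invariant functions are the constants, and the surface has a gap.

The gap for the two generators implies the gap for all generating sets
(`hasSpectralGap_of_exists_pair`), and the gap, applied to indicator functions, implies expansion in
measure (`HasSpectralGap.measureExpanding`).
-/

open scoped InnerProductSpace

noncomputable section

/-! ### Freeness of the two unipotent matrices -/

/-- The linear action of `SL₂(ℤ)` on the nonzero integer vectors. -/
@[reducible] def nonzeroVecAction :
    MulAction (Matrix.SpecialLinearGroup (Fin 2) ℤ) {v : Fin 2 → ℤ // v ≠ 0} where
  smul A v := ⟨A.1.mulVec v.1, fun h => v.2 <| by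
    have h' : (A⁻¹).1.mulVec (A.1.mulVec v.1) = 0 := by rw [h, Matrix.mulVec_zero]
    rwa [Matrix.mulVec_mulVec, ← Matrix.SpecialLinearGroup.coe_mul, inv_mul_cancel,
      Matrix.SpecialLinearGroup.coe_one, Matrix.one_mulVec] at h'⟩
  one_smul v := Subtype.ext (Matrix.one_mulVec v.1)
  mul_smul A B v := Subtype.ext (Matrix.mulVec_mulVec v.1 A.1 B.1).symm

open scoped Pointwise in
/-- `a_k` and `b_k` freely generate a free group. In terms of the slope `t = v₀ / v₁ ∈ ℚ ∪ {∞}`,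
the generator `a_k` is `t ↦ t + k` and `b_k` is `t⁻¹ ↦ t⁻¹ + k`. The ping-pong sets are `1 < t ≤ ∞` and `t ≤ -1` for
`a_k`, and `0 ≤ t ≤ 1` and `-1 < t < 0` for `b_k`. -/
theorem freeToSL_injective (k : ℕ) (hk : 2 ≤ k) : Function.Injective (freeToSL k) := by
  let := nonzeroVecAction
  have hk' : (2 : ℤ) ≤ k := by exact_mod_cast hk
  have ha : ∀ v : {v : Fin 2 → ℤ // v ≠ 0}, (matA k • v).1 = ![v.1 0 + k * v.1 1, v.1 1] := by
    intro v
    change (matA k).1.mulVec v.1 = _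
    ext i; fin_cases i <;> simp [matA, Matrix.mulVec, dotProduct, Fin.sum_univ_two]
  have hb : ∀ v : {v : Fin 2 → ℤ // v ≠ 0}, (matB k • v).1 = ![v.1 0, k * v.1 0 + v.1 1] := by
    intro v
    change (matB k).1.mulVec v.1 = _
    ext i; fin_cases i <;> simp [matB, Matrix.mulVec, dotProduct, Fin.sum_univ_two]
  have hpos : ∀ v : {v : Fin 2 → ℤ // v ≠ 0}, 0 < v.1 0 ^ 2 + v.1 1 ^ 2 := by
    intro v
    have : v.1 0 ≠ 0 ∨ v.1 1 ≠ 0 := by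
      by_contra! h
      exact v.2 (by ext i; fin_cases i <;> simp [h.1, h.2])
    rcases this with h | h <;> positivity
  let Xa : Set {v : Fin 2 → ℤ // v ≠ 0} := {v | v.1 1 = 0 ∨ v.1 1 ^ 2 < v.1 0 * v.1 1}
  let Ya : Set {v : Fin 2 → ℤ // v ≠ 0} := {v | v.1 1 ≠ 0 ∧ v.1 0 * v.1 1 ≤ - v.1 1 ^ 2}
  let Xb : Set {v : Fin 2 → ℤ // v ≠ 0} := {v | v.1 0 = 0 ∨ v.1 0 ^ 2 ≤ v.1 0 * v.1 1}
  let Yb : Set {v : Fin 2 → ℤ // v ≠ 0} := {v | v.1 0 ≠ 0 ∧ v.1 0 * v.1 1 < - v.1 0 ^ 2}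
  have pair : ∀ {P Q : Set {v : Fin 2 → ℤ // v ≠ 0}}, Disjoint P Q →
      Pairwise (Function.onFun Disjoint ![P, Q]) := by
    intro P Q h i j hij
    fin_cases i <;> fin_cases j <;> first | exact absurd rfl hij | exact h | exact h.symm
  refine FreeGroup.injective_lift_of_ping_pong (α := {v : Fin 2 → ℤ // v ≠ 0})
    ![matA k, matB k] ![Xa, Xb] ![Ya, Yb] ?_ (pair ?_) (pair ?_) ?_ ?_ ?_
  · intro i; fin_cases i
    · exact ⟨⟨![1, 0], by simp⟩, by simp [Xa]⟩
    · exact ⟨⟨![0, 1], by simp⟩, by simp [Xb]⟩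
  · refine Set.disjoint_left.2 fun v hv hw => ?_
    have := hpos v
    rcases hv with hv | hv <;> rcases hw with hw | hw
    · simp [hv, hw] at this
    · simp only [hv] at hw this; linarith
    · simp only [hw] at hv this; linarith
    · nlinarith [sq_nonneg (v.1 0 - v.1 1)]
  · refine Set.disjoint_left.2 fun v hv hw => ?_
    nlinarith [hv.2, hw.2, sq_nonneg (v.1 0 + v.1 1)]
  · have haa : Disjoint Xa Ya := Set.disjoint_left.2 fun v hv hw => by
      have := hw.1
      rcases hv with hv | hv
      · exact this hv
      · nlinarith [hw.2, sq_nonneg (v.1 1)]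
    have hab : Disjoint Xa Yb := Set.disjoint_left.2 fun v hv hw => by
      have := hw.2
      rcases hv with hv | hv
      · simp only [hv] at this; nlinarith [sq_nonneg (v.1 0)]
      · nlinarith [sq_nonneg (v.1 1), sq_nonneg (v.1 0)]
    have hba : Disjoint Xb Ya := Set.disjoint_left.2 fun v hv hw => by
      have := hw.2
      have := hpos v
      rcases hv with hv | hv
      · simp only [hv] at *; nlinarith [sq_nonneg (v.1 1)]
      · nlinarith
    have hbb : Disjoint Xb Yb := Set.disjoint_left.2 fun v hv hw => by
      have := hw.1
      rcases hv with hv | hv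
      · exact this hv
      · nlinarith [hw.2, sq_nonneg (v.1 0)]
    intro i j
    fin_cases i <;> fin_cases j <;> assumption
  · intro i
    fin_cases i
    · rintro _ ⟨v, hv, rfl⟩
      change matA k • v ∈ Xa
      change v ∉ Ya at hv
      simp only [Xa, Ya, Set.mem_ofPred_eq, ha, not_and, not_le] at hv ⊢
      by_cases h : v.1 1 = 0
      · left; simpa using h
      · right
        have := hv h
        have : 0 < v.1 1 ^ 2 := by positivity
        simp; nlinarith
    · rintro _ ⟨v, hv, rfl⟩
      change matB k • v ∈ Xb
      change v ∉ Yb at hv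
      simp only [Xb, Yb, Set.mem_ofPred_eq, hb, not_and, not_lt] at hv ⊢
      by_cases h : v.1 0 = 0
      · left; simpa using h
      · right
        have := hv h
        have : 0 < v.1 0 ^ 2 := by positivity
        simp; nlinarith
  · intro i
    fin_cases i
    · rintro _ ⟨v, hv, rfl⟩
      change (matA k)⁻¹ • v ∈ Ya
      change v ∉ Xa at hv
      obtain ⟨w, rfl⟩ : ∃ w, v = matA k • w := ⟨(matA k)⁻¹ • v, by simp⟩
      rw [inv_smul_smul]
      simp only [Xa, Ya, Set.mem_ofPred_eq, ha, not_or, not_lt] at hv ⊢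
      simp only [Matrix.cons_val_zero, Matrix.cons_val_one] at hv
      have : 0 < w.1 1 ^ 2 := by have := hv.1; positivity
      exact ⟨hv.1, by nlinarith [hv.2]⟩
    · rintro _ ⟨v, hv, rfl⟩
      change (matB k)⁻¹ • v ∈ Yb
      change v ∉ Xb at hv
      obtain ⟨w, rfl⟩ : ∃ w, v = matB k • w := ⟨(matB k)⁻¹ • v, by simp⟩
      rw [inv_smul_smul]
      simp only [Xb, Yb, Set.mem_ofPred_eq, hb, not_or, not_le] at hv ⊢
      simp only [Matrix.cons_val_zero, Matrix.cons_val_one] at hv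
      have : 0 < w.1 0 ^ 2 := by have := hv.1; positivity
      exact ⟨hv.1, by nlinarith [hv.2]⟩

/-! ### Fourier coefficients on the torus -/

/-- The character `(x, y) ↦ exp (2πi (n₁ x + n₂ y))` of the torus. -/
def torusChar (n : ℤ × ℤ) (z : Torus) : ℂ := fourier n.1 z.1 * fourier n.2 z.2

/-- The Fourier coefficients of a function on the torus. -/
def torusCoeff (h : Torus → ℂ) (n : ℤ × ℤ) : ℂ := ∫ z, torusChar (-n) z * h z

theorem continuous_torusChar (n : ℤ × ℤ) : Continuous (torusChar n) := by
  unfold torusChar; fun_prop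

theorem norm_torusChar (n : ℤ × ℤ) (z : Torus) : ‖torusChar n z‖ = 1 := by
  simp only [torusChar, fourier_apply, norm_mul, Circle.norm_coe, mul_one]

theorem volume_unitAddCircle_eq_haar :
    (volume : Measure UnitAddCircle) = AddCircle.haarAddCircle := by
  simp [AddCircle.volume_eq_smul_haarAddCircle]

/-- Parseval's identity on the torus. -/
theorem hasSum_sq_torusCoeff {h : Torus → ℂ} (hh : MemLp h 2) :
    HasSum (fun n => ‖torusCoeff h n‖ ^ 2) (∫ z, ‖h z‖ ^ 2) := by
  let e : (Fin 2 → UnitAddCircle) ≃ᵐ Torus := MeasurableEquiv.finTwoArrow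
  have he : MeasurePreserving e (Measure.pi fun _ => AddCircle.haarAddCircle) volume := by
    have := measurePreserving_finTwoArrow (AddCircle.haarAddCircle (T := (1 : ℝ)))
    rwa [← volume_unitAddCircle_eq_haar] at this ⊢
  have hg : MemLp (h ∘ e) 2 (Measure.pi fun _ => AddCircle.haarAddCircle) :=
    hh.comp_measurePreserving he
  have hcoe := hg.coeFn_toLp
  have key := UnitAddTorus.hasSum_sq_mFourierCoeff (hg.toLp _)
  have h1 : ∫ z, ‖h z‖ ^ 2 =
      ∫ x, ‖hg.toLp (h ∘ e) x‖ ^ 2 ∂(Measure.pi fun _ => AddCircle.haarAddCircle) := by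
    rw [← he.integral_comp e.measurableEmbedding]
    refine integral_congr_ae ?_
    filter_upwards [hcoe] with x hx
    rw [hx, Function.comp]
  have h2 : ∀ n : Fin 2 → ℤ, UnitAddTorus.mFourierCoeff (hg.toLp (h ∘ e)) n
      = torusCoeff h (n 0, n 1) := by
    intro n
    rw [torusCoeff, ← he.integral_comp e.measurableEmbedding]
    refine integral_congr_ae ?_
    filter_upwards [hcoe] with x hx
    rw [hx, Function.comp, smul_eq_mul]
    congr 1
    simp [UnitAddTorus.mFourier, torusChar, e, Fin.prod_univ_two, MeasurableEquiv.finTwoArrow]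
  rw [h1]
  rw [← (finTwoArrowEquiv ℤ).hasSum_iff]
  refine key.congr_fun fun n => ?_
  rw [h2]; rfl

theorem fourier_zsmul (n m : ℤ) (x : UnitAddCircle) : fourier n (m • x) = fourier (n * m) x := by
  rw [fourier_apply, fourier_apply, mul_zsmul]

theorem torusChar_torusAct (A : Matrix.SpecialLinearGroup (Fin 2) ℤ) (n : ℤ × ℤ) (z : Torus) :
    torusChar n (torusAct A z) =
      torusChar (n.1 * A 0 0 + n.2 * A 1 0, n.1 * A 0 1 + n.2 * A 1 1) z := by
  have hadd : ∀ (n : ℤ) (x y : UnitAddCircle), fourier n (x + y) = fourier n x * fourier n y := by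
    intro n x y
    simp [fourier_apply, smul_add, AddCircle.toCircle_add]
  simp only [torusChar, torusAct, hadd, fourier_zsmul, fourier_add]
  ring

theorem torusAct_mul (A B : Matrix.SpecialLinearGroup (Fin 2) ℤ) (z : Torus) :
    torusAct (A * B) z = torusAct A (torusAct B z) := by
  simp only [torusAct, Matrix.SpecialLinearGroup.coe_mul, Matrix.mul_apply, Fin.sum_univ_two]
  ext <;> simp only [add_smul, mul_smul, smul_add] <;> abel

theorem torusAct_one (z : Torus) : torusAct 1 z = z := by
  simp [torusAct]

theorem continuous_torusAct (A : Matrix.SpecialLinearGroup (Fin 2) ℤ) :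
    Continuous (torusAct A) := by
  unfold torusAct; fun_prop

theorem measurePreserving_torusAct (A : Matrix.SpecialLinearGroup (Fin 2) ℤ) :
    MeasurePreserving (torusAct A) := by
  let f : Torus →+ Torus :=
    { toFun := torusAct A
      map_zero' := by simp [torusAct]
      map_add' := fun x y => by
        ext <;> simp only [torusAct, Prod.fst_add, Prod.snd_add, smul_add] <;> abel }
  have : (volume : Measure Torus).IsAddHaarMeasure :=
    inferInstanceAs ((volume : Measure UnitAddCircle).prod volume).IsAddHaarMeasure
  refine AddMonoidHom.measurePreserving (f := f) (continuous_torusAct A) (fun z => ?_) rfl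
  exact ⟨torusAct A⁻¹ z, by
    change torusAct A _ = z
    rw [← torusAct_mul, mul_inv_cancel, torusAct_one]⟩

theorem torusCoeff_comp_torusAct (A : Matrix.SpecialLinearGroup (Fin 2) ℤ) {h : Torus → ℂ}
    (hh : AEStronglyMeasurable h) (n : ℤ × ℤ) :
    torusCoeff (fun z => h (torusAct A z))
      (n.1 * A 0 0 + n.2 * A 1 0, n.1 * A 0 1 + n.2 * A 1 1) = torusCoeff h n := by
  have hA := measurePreserving_torusAct A
  have hm : AEStronglyMeasurable (fun z => torusChar (-n) z * h z) :=
    (continuous_torusChar _).aestronglyMeasurable.mul hh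
  rw [torusCoeff, torusCoeff]
  conv_rhs => rw [← hA.map_eq]
  rw [integral_map hA.measurable.aemeasurable (by rwa [hA.map_eq])]
  refine integral_congr_ae (Filter.Eventually.of_forall fun z => ?_)
  simp only [torusChar_torusAct]
  congr 3
  ext <;> simp <;> ring

/-! ### Spectral gap on the torus -/

/-- If `F` is nearly invariant under the permutation `g`, then the mass of `‖F‖²` in the image of
`s` is at least two thirds of its mass in `s`, up to a small error. Any factor above one half would
serve for the ping-pong argument below. -/
theorem two_mul_tsum_le_three_mul_tsum_image {β : Type*} (F : β → ℂ) (g : β ≃ β)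
    (s : Set β) (δ : ℝ≥0∞)
    (hδ : ∑' n, ‖F (g n) - F n‖ₑ ^ 2 ≤ δ) :
    2 * ∑' n : s, ‖F n‖ₑ ^ 2 ≤ 3 * ∑' n : g '' s, ‖F n‖ₑ ^ 2 + 6 * δ := by
  have hpt : ∀ n, 2 * ‖F n‖ₑ ^ 2 ≤ 3 * ‖F (g n)‖ₑ ^ 2 + 6 * ‖F (g n) - F n‖ₑ ^ 2 := by
    intro n
    have h : 2 * ‖F n‖ ^ 2 ≤ 3 * ‖F (g n)‖ ^ 2 + 6 * ‖F (g n) - F n‖ ^ 2 := by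
      have h1 : ‖F n‖ ≤ ‖F (g n)‖ + ‖F (g n) - F n‖ := by
        have := norm_sub_le (F (g n)) (F (g n) - F n)
        simpa using this
      have h2 : ‖F n‖ ^ 2 ≤ (‖F (g n)‖ + ‖F (g n) - F n‖) ^ 2 := by gcongr
      nlinarith [sq_nonneg (‖F (g n)‖ - 2 * ‖F (g n) - F n‖)]
    have := ENNReal.ofReal_le_ofReal h
    rw [ENNReal.ofReal_add (by positivity) (by positivity)] at this
    simpa [ENNReal.ofReal_mul, ENNReal.ofReal_pow] using this
  have himg : ∑' n : g '' s, ‖F n‖ₑ ^ 2 = ∑' n : s, ‖F (g n)‖ₑ ^ 2 :=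
    (Equiv.tsum_eq (g.image s) (fun n : g '' s => ‖F n‖ₑ ^ 2)).symm
  calc 2 * ∑' n : s, ‖F n‖ₑ ^ 2
      = ∑' n : s, 2 * ‖F n‖ₑ ^ 2 := ENNReal.tsum_mul_left.symm
    _ ≤ ∑' n : s, (3 * ‖F (g n)‖ₑ ^ 2 + 6 * ‖F (g n) - F n‖ₑ ^ 2) :=
        ENNReal.tsum_le_tsum fun n => hpt n
    _ = 3 * ∑' n : s, ‖F (g n)‖ₑ ^ 2 + 6 * ∑' n : s, ‖F (g n) - F n‖ₑ ^ 2 := by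
        rw [ENNReal.tsum_add, ENNReal.tsum_mul_left, ENNReal.tsum_mul_left]
    _ ≤ _ := by
        rw [himg]
        gcongr
        exact (ENNReal.tsum_comp_le_tsum_of_injective Subtype.val_injective
          (fun n => ‖F (g n) - F n‖ₑ ^ 2)).trans hδ

theorem abs_lt_abs_add_mul {p q k : ℤ} (hk : 2 ≤ |k|) (h : |p| < |q|) : |q| < |p + q * k| := by
  have h1 : 2 * |q| ≤ |q * k| := by
    rw [abs_mul, mul_comm]; gcongr
  have h2 : |q * k| ≤ |p + q * k| + |p| := by
    simpa using abs_sub (p + q * k) p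
  linarith

theorem add_mul_ne_sub_mul {p p' q k : ℤ} (hk : 2 ≤ |k|) (h : |p| < |q|) (h' : |p'| < |q|) :
    p' - q * k ≠ p + q * k := by
  intro he
  have h1 : 2 * |q| ≤ |q * k| := by
    rw [abs_mul, mul_comm]; gcongr
  have h2 : |2 * (q * k)| ≤ |p'| + |p| := by
    rw [show 2 * (q * k) = p' - p by linarith]; exact abs_sub p' p
  rw [abs_mul, abs_two] at h2
  linarith [abs_nonneg q]

/-- A square-summable function on `ℤ²` which is nearly invariant under the unipotents `a` and `b`
has little mass outside the origin. Write `X = {|p| < |q|}` and `Y = {|q| < |p|}`. The unipotent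
`b` and its inverse map `X` onto two disjoint subsets of `Y`, so that `Y` has about twice as much
mass as `X`, and likewise with `X` and `Y` exchanged. Hence both have little mass, and the diagonals
`P` and `Q`, which are mapped into `X`, do as well. -/
theorem tsum_ne_zero_le_of_unipotent (F : ℤ × ℤ → ℂ) {k : ℤ} (hk : 2 ≤ k) (δ : ℝ≥0∞)
    (hF : ∑' n, ‖F n‖ₑ ^ 2 ≠ ∞) (hδ : δ ≠ ∞)
    (ha : ∑' n : ℤ × ℤ, ‖F (n.1, n.1 * k + n.2) - F n‖ₑ ^ 2 ≤ δ)
    (hb : ∑' n : ℤ × ℤ, ‖F (n.1 + n.2 * k, n.2) - F n‖ₑ ^ 2 ≤ δ) :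
    ∑' n : {n : ℤ × ℤ | n ≠ 0}, ‖F n‖ₑ ^ 2 ≤ 102 * δ := by
  let a : ℤ × ℤ ≃ ℤ × ℤ :=
    ⟨fun n => (n.1, n.1 * k + n.2), fun n => (n.1, n.2 - n.1 * k),
      fun n => by simp, fun n => by simp⟩
  let b : ℤ × ℤ ≃ ℤ × ℤ :=
    ⟨fun n => (n.1 + n.2 * k, n.2), fun n => (n.1 - n.2 * k, n.2),
      fun n => by simp, fun n => by simp⟩
  have hinv : ∀ g : ℤ × ℤ ≃ ℤ × ℤ, ∑' n, ‖F (g n) - F n‖ₑ ^ 2 ≤ δ →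
      ∑' n, ‖F (g.symm n) - F n‖ₑ ^ 2 ≤ δ := by
    intro g hg
    rw [← Equiv.tsum_eq g]
    simpa [enorm_sub_rev] using hg
  let ν : Set (ℤ × ℤ) → ℝ≥0∞ := fun s => ∑' n : s, ‖F n‖ₑ ^ 2
  have hmono : ∀ {s t}, s ⊆ t → ν s ≤ ν t := fun h =>
    ENNReal.tsum_mono_subtype (fun n => ‖F n‖ₑ ^ 2) h
  have hunion : ∀ s t, ν (s ∪ t) ≤ ν s + ν t := fun s t =>
    ENNReal.tsum_union_le (fun n => ‖F n‖ₑ ^ 2) s t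
  have hdisj : ∀ s t, Disjoint s t → ν (s ∪ t) = ν s + ν t := fun s t h =>
    ENNReal.summable.tsum_union_disjoint (f := fun n => ‖F n‖ₑ ^ 2) h ENNReal.summable
  have hfin : ∀ s, ν s ≠ ∞ := fun s => ne_top_of_le_ne_top hF <|
    ENNReal.tsum_comp_le_tsum_of_injective Subtype.val_injective _
  have step : ∀ (g : ℤ × ℤ ≃ ℤ × ℤ) (s : Set (ℤ × ℤ)), ∑' n, ‖F (g n) - F n‖ₑ ^ 2 ≤ δ →
      2 * ν s ≤ 3 * ν (g '' s) + 6 * δ := fun g s hg =>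
    two_mul_tsum_le_three_mul_tsum_image F g s δ hg
  let X : Set (ℤ × ℤ) := {n | |n.1| < |n.2|}
  let Y : Set (ℤ × ℤ) := {n | |n.2| < |n.1|}
  let P : Set (ℤ × ℤ) := {n | n.1 = n.2 ∧ n.1 ≠ 0}
  let Q : Set (ℤ × ℤ) := {n | n.1 = -n.2 ∧ n.1 ≠ 0}
  have hk1 : 2 ≤ |k| := hk.trans (le_abs_self k)
  have hk2 : 2 ≤ |-k| := by rwa [abs_neg]
  have hX : ν (b '' X) + ν (b.symm '' X) ≤ ν Y := by
    rw [← hdisj]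
    · refine hmono (Set.union_subset ?_ ?_)
      · rintro _ ⟨⟨p, q⟩, hn, rfl⟩
        exact abs_lt_abs_add_mul hk1 (show |p| < |q| from hn)
      · rintro _ ⟨⟨p, q⟩, hn, rfl⟩
        have := abs_lt_abs_add_mul hk2 (show |p| < |q| from hn)
        rwa [mul_neg, ← sub_eq_add_neg] at this
    · rw [Set.disjoint_left]
      rintro _ ⟨⟨p, q⟩, hn, rfl⟩ ⟨⟨p', q'⟩, hn', h⟩
      obtain rfl : q' = q := congrArg Prod.snd h
      exact add_mul_ne_sub_mul hk1 (show |p| < |q'| from hn) (show |p'| < |q'| from hn')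
        (congrArg Prod.fst h)
  have hY : ν (a '' Y) + ν (a.symm '' Y) ≤ ν X := by
    rw [← hdisj]
    · refine hmono (Set.union_subset ?_ ?_)
      · rintro _ ⟨⟨p, q⟩, hn, rfl⟩
        have := abs_lt_abs_add_mul hk1 (show |q| < |p| from hn)
        rwa [add_comm] at this
      · rintro _ ⟨⟨p, q⟩, hn, rfl⟩
        have := abs_lt_abs_add_mul hk2 (show |q| < |p| from hn)
        rwa [mul_neg, ← sub_eq_add_neg] at this
    · rw [Set.disjoint_left]
      rintro _ ⟨⟨p, q⟩, hn, rfl⟩ ⟨⟨p', q'⟩, hn', h⟩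
      obtain rfl : p' = p := congrArg Prod.fst h
      exact add_mul_ne_sub_mul hk1 (show |q| < |p'| from hn) (show |q'| < |p'| from hn')
        ((congrArg Prod.snd h).trans (add_comm _ _))
  have hP : ν (a '' P) ≤ ν X := by
    refine hmono ?_
    rintro _ ⟨⟨p, q⟩, ⟨h1, h2⟩, rfl⟩
    change |p| < |p * k + q|
    change p = q at h1
    change p ≠ 0 at h2
    have : p * k + q = p * (k + 1) := by rw [← h1]; ring
    rw [this, abs_mul, abs_of_pos (by omega : 0 < k + 1)]
    nlinarith [abs_pos.2 h2]
  have hQ : ν (a.symm '' Q) ≤ ν X := by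
    refine hmono ?_
    rintro _ ⟨⟨p, q⟩, ⟨h1, h2⟩, rfl⟩
    change |p| < |q - p * k|
    change p = -q at h1
    change p ≠ 0 at h2
    have : q - p * k = -(p * (k + 1)) := by rw [← neg_neg q, ← h1]; ring
    rw [this, abs_neg, abs_mul, abs_of_pos (by omega : 0 < k + 1)]
    nlinarith [abs_pos.2 h2]
  have hcover : ν {n | n ≠ 0} ≤ ν X + ν Y + (ν P + ν Q) := by
    refine (hmono (t := (X ∪ Y) ∪ (P ∪ Q)) ?_).trans ((hunion _ _).trans
      (add_le_add (hunion _ _) (hunion _ _)))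
    rintro ⟨p, q⟩ hn
    change (|p| < |q| ∨ |q| < |p|) ∨ ((p = q ∧ p ≠ 0) ∨ (p = -q ∧ p ≠ 0))
    rcases lt_trichotomy |p| |q| with h | h | h
    · exact Or.inl (Or.inl h)
    · right
      have hp : p ≠ 0 := by
        rintro rfl
        rw [abs_zero, eq_comm, abs_eq_zero] at h
        exact hn (by rw [h]; rfl)
      exact (abs_eq_abs.1 h).imp (fun e => ⟨e, hp⟩) (fun e => ⟨e, hp⟩)
    · exact Or.inl (Or.inr h)
  have e1 := step b X hb
  have e2 := step b.symm X (hinv b hb)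
  have e3 := step a Y ha
  have e4 := step a.symm Y (hinv a ha)
  have e5 := step a P ha
  have e6 := step a.symm Q (hinv a ha)
  -- Adding up, `ν X + ν Y ≤ 24 δ`, hence `ν P + ν Q ≤ 3 ν X + 6 δ ≤ 78 δ`.
  change ν {n | n ≠ 0} ≤ 102 * δ
  lift δ to ℝ≥0 using hδ
  obtain ⟨μ, hμ⟩ : ∃ μ : Set (ℤ × ℤ) → ℝ≥0, ∀ s, ν s = μ s :=
    ⟨fun s => (ν s).toNNReal, fun s => (ENNReal.coe_toNNReal (hfin s)).symm⟩
  simp only [hμ] at *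
  norm_cast at *
  simp only [← NNReal.coe_le_coe] at *
  push_cast at *
  linarith

instance : IsProbabilityMeasure (volume : Measure UnitAddCircle) :=
  ⟨UnitAddCircle.measure_univ⟩

instance : IsProbabilityMeasure (volume : Measure Torus) :=
  inferInstanceAs (IsProbabilityMeasure ((volume : Measure UnitAddCircle).prod volume))

theorem tsum_sq_torusCoeff {u : Torus → ℝ} (hu : MemLp u 2) :
    ∑' n, ‖torusCoeff (fun z => (u z : ℂ)) n‖ₑ ^ 2 = ENNReal.ofReal (∫ z, u z ^ 2) := by
  have := hasSum_sq_torusCoeff (h := fun z => (u z : ℂ)) hu.ofReal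
  simp only [Complex.norm_real, Real.norm_eq_abs, sq_abs] at this
  rw [← this.tsum_eq, ENNReal.ofReal_tsum_of_nonneg (fun _ => by positivity) this.summable]
  simp [ENNReal.ofReal_pow]

/-- The Fourier coefficients of `u ∘ A` are those of `u` permuted by the transpose of `A`. -/
theorem tsum_sq_torusCoeff_sub {u : Torus → ℝ} (hu : MemLp u 2)
    (A : Matrix.SpecialLinearGroup (Fin 2) ℤ) :
    ∑' n : ℤ × ℤ, ‖torusCoeff (fun z => (u z : ℂ))
        (n.1 * A 0 0 + n.2 * A 1 0, n.1 * A 0 1 + n.2 * A 1 1)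
      - torusCoeff (fun z => (u z : ℂ)) n‖ₑ ^ 2 =
      ENNReal.ofReal (∫ z, (u (torusAct A z) - u z) ^ 2) := by
  have huA : MemLp (fun z => u (torusAct A z)) 2 :=
    hu.comp_measurePreserving (measurePreserving_torusAct A)
  have hint : ∀ {v : Torus → ℝ}, MemLp v 2 → ∀ n,
      Integrable fun z => torusChar (-n) z * (v z : ℂ) := by
    intro v hv n
    refine ((hv.ofReal (K := ℂ)).integrable one_le_two).bdd_mul (c := 1)
      (continuous_torusChar _).aestronglyMeasurable ?_
    exact Filter.Eventually.of_forall fun z => (norm_torusChar _ _).le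
  have hdet : A 0 0 * A 1 1 - A 0 1 * A 1 0 = 1 := by
    rw [← Matrix.det_fin_two]; exact A.2
  let g : ℤ × ℤ ≃ ℤ × ℤ :=
    { toFun := fun n => (n.1 * A 0 0 + n.2 * A 1 0, n.1 * A 0 1 + n.2 * A 1 1)
      invFun := fun n => (n.1 * A 1 1 - n.2 * A 1 0, n.2 * A 0 0 - n.1 * A 0 1)
      left_inv := fun n => by
        ext
        · linear_combination n.1 * hdet
        · linear_combination n.2 * hdet
      right_inv := fun n => by
        ext
        · linear_combination n.1 * hdet
        · linear_combination n.2 * hdet }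
  have hpars := tsum_sq_torusCoeff (u := fun z => u (torusAct A z) - u z) (huA.sub hu)
  rw [← hpars, ← Equiv.tsum_eq g (fun n =>
    ‖torusCoeff (fun z => ((u (torusAct A z) - u z : ℝ) : ℂ)) n‖ₑ ^ 2)]
  refine tsum_congr fun n => ?_
  have h1 : torusCoeff (fun z => ((u (torusAct A z) - u z : ℝ) : ℂ)) (g n) =
      torusCoeff (fun z => (u z : ℂ)) n - torusCoeff (fun z => (u z : ℂ)) (g n) := by
    have h2 : torusCoeff (fun z => (u (torusAct A z) : ℂ)) (g n) =
        torusCoeff (fun z => (u z : ℂ)) n :=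
      torusCoeff_comp_torusAct A (hu.ofReal (K := ℂ)).aestronglyMeasurable n
    rw [← h2]
    simp only [torusCoeff, Complex.ofReal_sub, mul_sub]
    exact integral_sub (hint huA (g n)) (hint hu (g n))
  rw [enorm_sub_rev]
  exact (congrArg (fun c : ℂ => ‖c‖ₑ ^ 2) h1).symm

/-- The action of `⟨a_k, b_k⟩` on the torus has spectral gap. -/
theorem torus_spectral_gap {k : ℕ} (hk : 2 ≤ k) {h : Torus → ℝ} (hh : MemLp h 2) :
    ∫ z, (h z - ∫ w, h w) ^ 2 ≤
      102 * ((∫ z, (h (torusAct (matA k) z) - h z) ^ 2) +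
        ∫ z, (h (torusAct (matB k) z) - h z) ^ 2) := by
  set c := ∫ w, h w with hc
  have hu : MemLp (fun z => h z - c) 2 := hh.sub (memLp_const c)
  have h0 : torusCoeff (fun z => ((h z - c : ℝ) : ℂ)) 0 = 0 := by
    have : ∫ z, (h z - c) = 0 := by
      rw [integral_sub (hh.integrable one_le_two) (integrable_const c)]
      simp [← hc]
    simp [torusCoeff, torusChar, -Complex.ofReal_sub, integral_complex_ofReal, this]
  have eA := tsum_sq_torusCoeff_sub hu (matA k)
  have eB := tsum_sq_torusCoeff_sub hu (matB k)
  simp only [sub_sub_sub_cancel_right] at eA eB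
  have hnonneg : ∀ u : Torus → ℝ, 0 ≤ ∫ z, u z ^ 2 := fun u =>
    integral_nonneg fun z => sq_nonneg _
  have key := tsum_ne_zero_le_of_unipotent (torusCoeff fun z => ((h z - c : ℝ) : ℂ))
    (k := k) (by exact_mod_cast hk) (ENNReal.ofReal ((∫ z, (h (torusAct (matA k) z) - h z) ^ 2) +
        ∫ z, (h (torusAct (matB k) z) - h z) ^ 2))
    (by rw [tsum_sq_torusCoeff hu]; exact ENNReal.ofReal_ne_top) ENNReal.ofReal_ne_top
    (by
      refine le_of_eq_of_le ?_ (ENNReal.ofReal_le_ofReal (le_add_of_nonneg_right (hnonneg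
        fun z => h (torusAct (matB k) z) - h z)))
      simpa [matA] using eA)
    (by
      refine le_of_eq_of_le ?_ (ENNReal.ofReal_le_ofReal (le_add_of_nonneg_left (hnonneg
        fun z => h (torusAct (matA k) z) - h z)))
      simpa [matB] using eB)
  have htot : ∑' n : {n : ℤ × ℤ | n ≠ 0}, ‖torusCoeff (fun z => ((h z - c : ℝ) : ℂ)) n‖ₑ ^ 2 =
      ENNReal.ofReal (∫ z, (h z - c) ^ 2) := by
    rw [← tsum_sq_torusCoeff hu]
    refine tsum_subtype_eq_of_support_subset (f := fun n =>
      ‖torusCoeff (fun z => ((h z - c : ℝ) : ℂ)) n‖ₑ ^ 2) fun n hn => ?_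
    rintro rfl
    exact hn (by simp only [h0]; simp)
  rw [htot, show (102 : ℝ≥0∞) = ENNReal.ofReal 102 by simp,
    ← ENNReal.ofReal_mul (p := 102) (by norm_num)] at key
  refine (ENNReal.ofReal_le_ofReal_iff (mul_nonneg (by norm_num) (add_nonneg ?_ ?_))).1 key
  · exact hnonneg fun z => h (torusAct (matA k) z) - h z
  · exact hnonneg fun z => h (torusAct (matB k) z) - h z

/-! ### Almost invariant vectors in Hilbert spaces -/

section Hilbert
variable {H E : Type*} [NormedAddCommGroup H] [InnerProductSpace ℝ H] [CompleteSpace H]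
  [NormedAddCommGroup E] [InnerProductSpace ℝ E] [CompleteSpace E]

/-- Almost-kernel vectors are almost orthogonal to any fixed vector orthogonal to the kernel,
because the range of the adjoint is dense in the orthogonal complement of the kernel. -/
theorem exists_forall_abs_inner_le (T : H →L[ℝ] E) {v : H} (hv : v ∈ T.kerᗮ) {δ : ℝ} (hδ : 0 < δ) :
    ∃ ε > 0, ∀ f : H, ‖f‖ = 1 → ‖T f‖ ≤ ε → |⟪f, v⟫_ℝ| ≤ δ := by
  rw [ContinuousLinearMap.orthogonal_ker, ← SetLike.mem_coe, Submodule.topologicalClosure_coe,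
    Metric.mem_closure_iff] at hv
  obtain ⟨_, ⟨w, rfl⟩, hw⟩ := hv (δ / 2) (half_pos hδ)
  refine ⟨δ / 2 / (‖w‖ + 1), by positivity, fun f hf hTf => ?_⟩
  change dist v (T.adjoint w) < δ / 2 at hw
  rw [dist_eq_norm] at hw
  have h1 : ⟪f, v⟫_ℝ = ⟪f, v - T.adjoint w⟫_ℝ + ⟪T f, w⟫_ℝ := by
    rw [inner_sub_right, ContinuousLinearMap.adjoint_inner_right]; ring
  have h2 : |⟪f, v - T.adjoint w⟫_ℝ| ≤ δ / 2 :=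
    (abs_real_inner_le_norm _ _).trans (by rw [hf, one_mul]; exact hw.le)
  have h3 : |⟪T f, w⟫_ℝ| ≤ δ / 2 := by
    refine (abs_real_inner_le_norm _ _).trans ?_
    calc ‖T f‖ * ‖w‖ ≤ δ / 2 / (‖w‖ + 1) * (‖w‖ + 1) := by gcongr; linarith
      _ = δ / 2 := by field_simp
  rw [h1]
  exact (abs_add_le _ _).trans (by linarith)

/-- If `T` is not bounded below on the orthogonal complement of its kernel, there are
arbitrarily large almost orthonormal families in the almost-kernel of `T`. -/
theorem exists_almost_orthonormal (T : H →L[ℝ] E)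
    (hT : ∀ ε > 0, ∃ f ∈ T.kerᗮ, ‖f‖ = 1 ∧ ‖T f‖ ≤ ε) {ε : ℝ} (hε : 0 < ε) (r : ℕ) :
    ∃ f : Fin r → H, (∀ i, f i ∈ T.kerᗮ) ∧ (∀ i, ‖f i‖ = 1) ∧ (∀ i, ‖T (f i)‖ ≤ ε) ∧
      ∀ i j, i ≠ j → |⟪f i, f j⟫_ℝ| ≤ ε := by
  induction r with
  | zero => exact ⟨fun i => i.elim0, fun i => i.elim0, fun i => i.elim0, fun i => i.elim0,
      fun i => i.elim0⟩
  | succ r ih =>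
    obtain ⟨f, hker, hnorm, hTf, horth⟩ := ih
    choose δ hδ hδf using fun i => exists_forall_abs_inner_le T (hker i) hε
    obtain ⟨η, hη, hηδ⟩ : ∃ η > 0, ∀ i, η ≤ δ i := by
      rcases isEmpty_or_nonempty (Fin r) with h | h
      · exact ⟨1, one_pos, fun i => h.elim i⟩
      · obtain ⟨i, hi⟩ := Finite.exists_min δ
        exact ⟨δ i, hδ i, hi⟩
    obtain ⟨g, hg, hg1, hTg⟩ := hT (min η ε) (lt_min hη hε)
    have hgf : ∀ i, |⟪g, f i⟫_ℝ| ≤ ε := fun i =>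
      hδf i g hg1 ((hTg.trans (min_le_left _ _)).trans (hηδ i))
    refine ⟨Fin.cons g f, fun i => ?_, fun i => ?_, fun i => ?_, fun i j hij => ?_⟩
    · refine Fin.cases ?_ (fun i => ?_) i
      · simpa using hg
      · simpa using hker i
    · refine Fin.cases ?_ (fun i => ?_) i
      · simpa using hg1
      · simpa using hnorm i
    · refine Fin.cases ?_ (fun i => ?_) i
      · simpa using hTg.trans (min_le_right _ _)
      · simpa using hTf i
    · revert hij
      refine Fin.cases ?_ (fun i => ?_) i <;> refine Fin.cases ?_ (fun j => ?_) j <;> intro hij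
      · exact absurd rfl hij
      · simpa using hgf j
      · simpa [real_inner_comm] using hgf i
      · simpa using horth i j fun h => hij (by rw [h])

end Hilbert

/-- Vectors of length less than their number are linearly dependent, so their Gram matrix is not
close to the identity. -/
theorem one_le_sum_abs_gram_sub {ι κ : Type*} [Fintype ι] [Fintype κ] [DecidableEq κ]
    (hcard : Fintype.card ι < Fintype.card κ) (v : κ → ι → ℝ) :
    1 ≤ ∑ i, ∑ j, |(∑ l, v i l * v j l) - if i = j then 1 else 0| := by
  by_contra! hlt
  let M : Matrix κ ι ℝ := Matrix.of v
  have hG : ∀ i j, (M * M.transpose) i j = ∑ l, v i l * v j l := fun i j => by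
    simp [M, Matrix.mul_apply]
  have hdet : (M * M.transpose).det = 0 := by
    by_contra hne
    have hu : IsUnit (M * M.transpose) :=
      (Matrix.isUnit_iff_isUnit_det _).2 (isUnit_iff_ne_zero.2 hne)
    have h1 := Matrix.rank_of_isUnit _ hu
    have h2 := Matrix.rank_mul_le_left M M.transpose
    have h3 := M.rank_le_card_width
    omega
  refine det_ne_zero_of_sum_row_lt_diag (A := M * M.transpose) (fun i => ?_) hdet
  have hrow : ∑ j, |(∑ l, v i l * v j l) - if i = j then 1 else 0| < 1 :=
    (Finset.single_le_sum (f := fun i => ∑ j, |(∑ l, v i l * v j l) - if i = j then 1 else 0|)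
      (fun i _ => Finset.sum_nonneg fun j _ => abs_nonneg _) (Finset.mem_univ i)).trans_lt hlt
  rw [← Finset.add_sum_erase _ _ (Finset.mem_univ i)] at hrow
  simp only [if_true] at hrow
  have h1 : ∑ j ∈ Finset.univ.erase i, |(∑ l, v i l * v j l) - if i = j then 1 else 0|
      = ∑ j ∈ Finset.univ.erase i, ‖(M * M.transpose) i j‖ := by
    refine Finset.sum_congr rfl fun j hj => ?_
    rw [if_neg (Finset.ne_of_mem_erase hj).symm, sub_zero, hG, Real.norm_eq_abs]
  rw [h1] at hrow
  have h2 : 1 - |(∑ l, v i l * v i l) - 1| ≤ ‖(M * M.transpose) i i‖ := by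
    rw [hG, Real.norm_eq_abs]
    have := abs_sub_abs_le_abs_sub 1 (∑ l, v i l * v i l)
    rw [abs_one, abs_sub_comm] at this
    linarith
  linarith

/-! ### Finite measured covers -/

theorem norm_sq_eq_integral_sq {X : Type*} [MeasurableSpace X] {μ : Measure X} (f : Lp ℝ 2 μ) :
    ‖f‖ ^ 2 = ∫ x, f x ^ 2 ∂μ := by
  rw [← real_inner_self_eq_norm_sq, L2.inner_def]
  refine integral_congr_ae (Filter.Eventually.of_forall fun x => ?_)
  simp [sq]

/-- The family `P i : Z → X`, `i : ι`, of measurable sections exhibits the measure `μ` on `X` as the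
lift of the measure `ν` on `Z` to a cover with fibres indexed by `ι`. -/
structure IsFiniteCover {ι Z X : Type*} [MeasurableSpace Z] [MeasurableSpace X]
    (P : ι → Z → X) (ν : Measure Z) (μ : Measure X) : Prop where
  measurable : ∀ i, Measurable (P i)
  eq_sum : μ = Measure.sum fun i => ν.map (P i)

/-- The map `A` of the cover permutes the fibres over the map `α` of the base. -/
def LiftsAlong {ι Z X : Type*} (P : ι → Z → X) (A : X → X) (α : Z → Z) : Prop :=
  ∀ z, ∃ c : Equiv.Perm ι, ∀ i, A (P i z) = P (c i) (α z)

namespace IsFiniteCover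

section Fiber

variable {ι Z X : Type*} [Fintype ι] {P : ι → Z → X}

/-- The Euclidean norm of the values of `f` over a point of the base. -/
noncomputable def fiberNorm (P : ι → Z → X) (f : X → ℝ) (z : Z) : ℝ :=
  ‖WithLp.toLp 2 fun i => f (P i z)‖

theorem sq_fiberNorm (f : X → ℝ) (z : Z) : fiberNorm P f z ^ 2 = ∑ i, f (P i z) ^ 2 := by
  simp [fiberNorm, EuclideanSpace.norm_sq_eq]

theorem fiberNorm_nonneg (f : X → ℝ) (z : Z) : 0 ≤ fiberNorm P f z := norm_nonneg _

theorem abs_fiberNorm_sub_le {A : X → X} {α : Z → Z} (hl : LiftsAlong P A α) (f : X → ℝ) (z : Z) :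
    |fiberNorm P f (α z) - fiberNorm P f z| ≤ fiberNorm P (fun x => f (A x) - f x) z := by
  have h : fiberNorm P f (α z) = fiberNorm P (fun x => f (A x)) z := by
    obtain ⟨c, hc⟩ := hl z
    rw [← sq_eq_sq₀ (fiberNorm_nonneg _ _) (fiberNorm_nonneg _ _)]
    simp only [sq_fiberNorm, hc]
    exact (Equiv.sum_comp c fun i => f (P i (α z)) ^ 2).symm
  rw [h]
  exact abs_norm_sub_norm_le _ _

end Fiber

variable {ι Z X : Type*} [MeasurableSpace Z] [MeasurableSpace X]
  {P : ι → Z → X} {ν : Measure Z} {μ : Measure X}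

theorem map_le (hP : IsFiniteCover P ν μ) (i : ι) : ν.map (P i) ≤ μ := by
  rw [hP.eq_sum]; exact Measure.le_sum _ i

theorem ae_base [Countable ι] (hP : IsFiniteCover P ν μ) {p : X → Prop} (h : ∀ᵐ x ∂μ, p x) :
    ∀ᵐ z ∂ν, ∀ i, p (P i z) :=
  ae_all_iff.2 fun i => ae_of_ae_map (hP.measurable i).aemeasurable
    (ae_mono (hP.map_le i) h)

theorem memLp_comp (hP : IsFiniteCover P ν μ) {f : X → ℝ} {p : ℝ≥0∞} (hf : MemLp f p μ) (i : ι) :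
    MemLp (fun z => f (P i z)) p ν :=
  (hf.mono_measure (hP.map_le i)).comp_of_map (hP.measurable i).aemeasurable

variable [Fintype ι]

theorem lintegral_eq (hP : IsFiniteCover P ν μ) {g : X → ℝ≥0∞} (hg : Measurable g) :
    ∫⁻ x, g x ∂μ = ∫⁻ z, ∑ i, g (P i z) ∂ν := by
  have hi : ∀ i, Measurable fun z => g (P i z) := fun i => hg.comp (hP.measurable i)
  rw [hP.eq_sum, lintegral_sum_measure, tsum_fintype, lintegral_finsetSum _ fun i _ => hi i]
  exact Finset.sum_congr rfl fun i _ => lintegral_map hg (hP.measurable i)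

theorem measurePreserving (hP : IsFiniteCover P ν μ) {A : X → X} {α : Z → Z} (hA : Measurable A)
    (hα : MeasurePreserving α ν ν) (hl : LiftsAlong P A α) : MeasurePreserving A μ μ := by
  refine ⟨hA, Measure.ext fun s hs => ?_⟩
  rw [Measure.map_apply hA hs, ← lintegral_indicator_one (hA hs), ← lintegral_indicator_one hs,
    hP.lintegral_eq (measurable_one.indicator (hA hs)),
    hP.lintegral_eq (measurable_one.indicator hs)]
  have hm : Measurable fun z => ∑ i, s.indicator (1 : X → ℝ≥0∞) (P i z) :=
    Finset.measurable_sum _ fun i _ => (measurable_one.indicator hs).comp (hP.measurable i)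
  rw [← hα.lintegral_comp hm]
  refine lintegral_congr fun z => ?_
  obtain ⟨c, hc⟩ := hl z
  rw [← Equiv.sum_comp c (fun i => s.indicator (1 : X → ℝ≥0∞) (P i (α z)))]
  refine Finset.sum_congr rfl fun i _ => ?_
  rw [← hc i]; rfl

theorem integral_eq (hP : IsFiniteCover P ν μ) {g : X → ℝ} (hg : Integrable g μ) :
    ∫ x, g x ∂μ = ∫ z, ∑ i, g (P i z) ∂ν := by
  have hi : ∀ i, Integrable g (ν.map (P i)) := fun i => hg.mono_measure (hP.map_le i)
  rw [hP.eq_sum, Measure.sum_fintype, integral_finsetSum_measure fun i _ => hi i,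
    integral_finsetSum]
  · exact Finset.sum_congr rfl fun i _ =>
      integral_map (hP.measurable i).aemeasurable (hi i).aestronglyMeasurable
  · exact fun i _ => (hi i).comp_measurable (hP.measurable i)

theorem memLp_fiberNorm (hP : IsFiniteCover P ν μ) {f : X → ℝ} (hf : MemLp f 2 μ) :
    MemLp (fiberNorm P f) 2 ν := by
  have hfi := hP.memLp_comp hf
  have hm : AEStronglyMeasurable (fiberNorm P f) ν := by
    have : fiberNorm P f = fun z => √(∑ i, f (P i z) ^ 2) := funext fun z => by
      rw [← sq_fiberNorm, Real.sqrt_sq (fiberNorm_nonneg f z)]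
    rw [this]
    refine Real.continuous_sqrt.comp_aestronglyMeasurable ?_
    exact Finset.aestronglyMeasurable_fun_sum _ fun i _ => (hfi i).aestronglyMeasurable.pow 2
  rw [memLp_two_iff_integrable_sq hm]
  simp only [sq_fiberNorm]
  exact integrable_finsetSum _ fun i _ => (hfi i).integrable_sq

theorem integral_sq_fiberNorm (hP : IsFiniteCover P ν μ) {f : X → ℝ} (hf : MemLp f 2 μ) :
    ∫ z, fiberNorm P f z ^ 2 ∂ν = ∫ x, f x ^ 2 ∂μ := by
  rw [hP.integral_eq hf.integrable_sq]
  simp only [sq_fiberNorm]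

/-- If `A` lifts `α`, then the fibre norm of `f` is at least as invariant under `α` as `f` is
under `A`. -/
theorem integral_sq_fiberNorm_sub_le (hP : IsFiniteCover P ν μ) {A : X → X} {α : Z → Z}
    (hA : MeasurePreserving A μ μ) (hα : MeasurePreserving α ν ν) (hl : LiftsAlong P A α)
    {f : X → ℝ} (hf : MemLp f 2 μ) :
    ∫ z, (fiberNorm P f (α z) - fiberNorm P f z) ^ 2 ∂ν ≤ ∫ x, (f (A x) - f x) ^ 2 ∂μ := by
  have hd : MemLp (fun x => f (A x) - f x) 2 μ := (hf.comp_measurePreserving hA).sub hf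
  have hh := hP.memLp_fiberNorm hf
  rw [← hP.integral_sq_fiberNorm hd]
  refine integral_mono ((hh.comp_measurePreserving hα).sub hh).integrable_sq
    (hP.memLp_fiberNorm hd).integrable_sq fun z => ?_
  exact sq_le_sq.2 ((abs_fiberNorm_sub_le hl f z).trans (le_abs_self _))

/-- Spectral gap with constant `C`, in its quadratic form, for the maps `α` and `β`: the variance of
a function is bounded by its displacement. -/
def _root_.HasQuadraticGap (ν : Measure Z) (α β : Z → Z) (C : ℝ) : Prop :=
  ∀ h : Z → ℝ, MemLp h 2 ν → ∫ z, (h z - ∫ w, h w ∂ν) ^ 2 ∂ν ≤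
    C * ((∫ z, (h (α z) - h z) ^ 2 ∂ν) + ∫ z, (h (β z) - h z) ^ 2 ∂ν)

/-- If the maps of the base have spectral gap, then the fibre norms of an almost invariant function
are almost constant. The parameter `η` comes from Young's inequality for the cross term. -/
theorem integral_abs_sum_sq_sub_le [IsProbabilityMeasure ν] (hP : IsFiniteCover P ν μ)
    {A B : X → X} {α β : Z → Z} (hA : MeasurePreserving A μ μ) (hB : MeasurePreserving B μ μ)
    (hα : MeasurePreserving α ν ν) (hβ : MeasurePreserving β ν ν)
    (hAα : LiftsAlong P A α) (hBβ : LiftsAlong P B β) {C : ℝ} (hC : 0 ≤ C)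
    (hgap : HasQuadraticGap ν α β C) {f : X → ℝ} (hf : MemLp f 2 μ) {η : ℝ} (hη : 0 < η) :
    ∫ z, |∑ i, f (P i z) ^ 2 - ∫ x, f x ^ 2 ∂μ| ∂ν ≤
      (2 + 1 / η) * C * ((∫ x, (f (A x) - f x) ^ 2 ∂μ) + ∫ x, (f (B x) - f x) ^ 2 ∂μ) +
        η * ∫ x, f x ^ 2 ∂μ := by
  have hh := hP.memLp_fiberNorm hf
  have hN := hP.integral_sq_fiberNorm hf
  set D := (∫ x, (f (A x) - f x) ^ 2 ∂μ) + ∫ x, (f (B x) - f x) ^ 2 ∂μ with hD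
  set N := ∫ x, f x ^ 2 ∂μ
  set h := fiberNorm P f
  set c := ∫ z, h z ∂ν with hc
  have hV : ∫ z, (h z - c) ^ 2 ∂ν ≤ C * D := by
    refine (hgap h hh).trans (mul_le_mul_of_nonneg_left (add_le_add ?_ ?_) hC)
    · exact hP.integral_sq_fiberNorm_sub_le hA hα hAα hf
    · exact hP.integral_sq_fiberNorm_sub_le hB hβ hBβ hf
  have hhc : MemLp (fun z => h z - c) 2 ν := hh.sub (memLp_const c)
  have hNV : N = (∫ z, (h z - c) ^ 2 ∂ν) + c ^ 2 := by
    have : ∀ z, (h z - c) ^ 2 = h z ^ 2 - (2 * c * h z - c ^ 2) := fun z => by ring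
    simp only [this]
    have hi1 : Integrable (fun z => 2 * c * h z) ν := (hh.integrable one_le_two).const_mul _
    have hi2 : Integrable (fun z => 2 * c * h z - c ^ 2) ν := hi1.sub (integrable_const _)
    rw [integral_sub hh.integrable_sq hi2, integral_sub hi1 (integrable_const _),
      integral_const_mul, ← hc, hN]
    simp; ring
  have hVnn : 0 ≤ ∫ z, (h z - c) ^ 2 ∂ν := integral_nonneg fun z => sq_nonneg _
  set V := ∫ z, (h z - c) ^ 2 ∂ν with hVdef
  have hpt : ∀ z, |∑ i, f (P i z) ^ 2 - N| ≤ (1 + 1 / η) * (h z - c) ^ 2 + (η * c ^ 2 + V) := by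
    intro z
    rw [← sq_fiberNorm]
    change |h z ^ 2 - N| ≤ _
    have e1 : |2 * c * (h z - c)| ≤ η * c ^ 2 + 1 / η * (h z - c) ^ 2 := by
      have hs : √η ^ 2 = η := Real.sq_sqrt hη.le
      have hs0 : 0 < √η := Real.sqrt_pos.2 hη
      have e : 1 / η * (h z - c) ^ 2 = ((h z - c) / √η) ^ 2 := by
        rw [div_pow, hs]; ring
      have e' : η * c ^ 2 = (√η * c) ^ 2 := by rw [mul_pow, hs]
      have e'' : 2 * c * (h z - c) = 2 * (√η * c) * ((h z - c) / √η) := by field_simp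
      rw [e, e', e'', abs_le]
      constructor
      · nlinarith [sq_nonneg (√η * c + (h z - c) / √η)]
      · nlinarith [sq_nonneg (√η * c - (h z - c) / √η)]
    have e2 : h z ^ 2 - N = (h z - c) ^ 2 + 2 * c * (h z - c) - V := by rw [hNV]; ring
    rw [e2]
    calc |(h z - c) ^ 2 + 2 * c * (h z - c) - V|
        ≤ |(h z - c) ^ 2| + |2 * c * (h z - c)| + |V| :=
          (abs_sub _ _).trans (add_le_add_left (abs_add_le _ _) _)
      _ ≤ (h z - c) ^ 2 + (η * c ^ 2 + 1 / η * (h z - c) ^ 2) + V := by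
          rw [abs_of_nonneg hVnn, abs_of_nonneg (sq_nonneg (h z - c))]; gcongr
      _ = _ := by ring
  have hi2 : Integrable (fun z => (1 + 1 / η) * (h z - c) ^ 2) ν := hhc.integrable_sq.const_mul _
  calc ∫ z, |∑ i, f (P i z) ^ 2 - N| ∂ν
      ≤ ∫ z, ((1 + 1 / η) * (h z - c) ^ 2 + (η * c ^ 2 + V)) ∂ν :=
        integral_mono_of_nonneg (Filter.Eventually.of_forall fun z => abs_nonneg _)
          (hi2.add (integrable_const _)) (Filter.Eventually.of_forall hpt)
    _ = (1 + 1 / η) * V + (η * c ^ 2 + V) := by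
        rw [integral_add hi2 (integrable_const _), integral_const_mul, integral_const,
          probReal_univ, one_smul]
    _ = (2 + 1 / η) * V + η * c ^ 2 := by ring
    _ ≤ (2 + 1 / η) * (C * D) + η * N := by
        gcongr
        linarith
    _ = _ := by ring

/-- **Spectral gap passes to finite covers**, away from the kernel of `T`, that is, on the
orthogonal complement of the invariant functions. Otherwise there are `n = #ι + 1` almost
orthonormal functions `f i` which are almost invariant. By polarisation and the gap of the base,
the fibrewise Gram matrices `∑ l, f i (P l z) * f j (P l z)` are almost constant in `z`, hence
close to the identity in the mean. But they are Gram matrices of `n` vectors in `ℝ^ι`. -/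
theorem exists_gap [IsProbabilityMeasure ν] (hP : IsFiniteCover P ν μ)
    {A B : X → X} {α β : Z → Z} (hA : MeasurePreserving A μ μ) (hB : MeasurePreserving B μ μ)
    (hα : MeasurePreserving α ν ν) (hβ : MeasurePreserving β ν ν)
    (hAα : LiftsAlong P A α) (hBβ : LiftsAlong P B β) {C : ℝ} (hC : 0 ≤ C)
    (hgap : HasQuadraticGap ν α β C)
    {E : Type*} [NormedAddCommGroup E] [InnerProductSpace ℝ E] [CompleteSpace E]
    (T : Lp ℝ 2 μ →L[ℝ] E)
    (hT : ∀ f, ‖T f‖ ^ 2 = (∫ x, (f (A x) - f x) ^ 2 ∂μ) + ∫ x, (f (B x) - f x) ^ 2 ∂μ) :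
    ∃ κ > 0, ∀ f ∈ T.kerᗮ, κ * ‖f‖ ≤ ‖T f‖ := by
  by_contra! hno
  have hno' : ∀ ε > 0, ∃ f ∈ T.kerᗮ, ‖f‖ = 1 ∧ ‖T f‖ ≤ ε := by
    intro ε hε
    obtain ⟨f, hf, hlt⟩ := hno ε hε
    have hf0 : 0 < ‖f‖ := by
      by_contra! h
      have : ‖f‖ = 0 := le_antisymm h (norm_nonneg _)
      rw [this, mul_zero] at hlt
      exact absurd (norm_nonneg _) (not_le.2 hlt)
    refine ⟨‖f‖⁻¹ • f, Submodule.smul_mem _ _ hf, ?_, ?_⟩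
    · rw [norm_smul, norm_inv, norm_norm, inv_mul_cancel₀ hf0.ne']
    · rw [map_smul, norm_smul, norm_inv, norm_norm, inv_mul_le_iff₀ hf0, mul_comm]
      exact hlt.le
  set n : ℕ := Fintype.card ι + 1 with hn
  have hn0 : (1 : ℝ) ≤ n := by rw [hn]; push_cast; linarith [(Fintype.card ι).cast_nonneg (α := ℝ)]
  have hn2 : (1 : ℝ) ≤ (n : ℝ) ^ 2 := one_le_pow₀ hn0
  -- `η` and `ε` are chosen so small that the `n²` entries of the Gram matrix deviate by less
  -- than `1 / n²` from those of the identity in the mean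
  set η : ℝ := 1 / (12 * (n : ℝ) ^ 2) with hη
  have hη0 : 0 < η := by positivity
  set L : ℝ := (2 + 1 / η) * C with hL
  have hL0 : 0 ≤ L := by positivity
  set ε : ℝ := 1 / (4 * (n : ℝ) ^ 2 * (1 + 3 * L)) with hε
  have hε0 : 0 < ε := by positivity
  have hε1 : ε ≤ 1 := by
    rw [hε, div_le_one (by positivity)]
    nlinarith
  have hsmall : (n : ℝ) ^ 2 * (3 * (L * ε ^ 2 + η) + ε) < 1 := by
    have h1 : (n : ℝ) ^ 2 * η = 1 / 12 := by rw [hη]; field_simp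
    have h2 : (n : ℝ) ^ 2 * ε * (1 + 3 * L) = 1 / 4 := by rw [hε]; field_simp
    have h3 : (n : ℝ) ^ 2 * (3 * L * ε ^ 2) ≤ (n : ℝ) ^ 2 * (3 * L * ε) := by
      gcongr
      nlinarith
    nlinarith
  obtain ⟨f, -, hnorm, hTf, horth⟩ := exists_almost_orthonormal T hno' hε0 n
  have hdev : ∀ g : Lp ℝ 2 μ, ∫ z, |∑ l, g (P l z) ^ 2 - ‖g‖ ^ 2| ∂ν ≤
      L * ‖T g‖ ^ 2 + η * ‖g‖ ^ 2 := by
    intro g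
    have := hP.integral_abs_sum_sq_sub_le hA hB hα hβ hAα hBβ hC hgap (Lp.memLp g) hη0
    rwa [← norm_sq_eq_integral_sq, ← hT] at this
  have hcomp : ∀ (g : Lp ℝ 2 μ) l, MemLp (fun z => g (P l z)) 2 ν := fun g l =>
    hP.memLp_comp (Lp.memLp g) l
  have hgram : ∀ i j, Integrable (fun z => ∑ l, f i (P l z) * f j (P l z)) ν := fun i j =>
    integrable_finsetSum _ fun l _ => (hcomp (f i) l).integrable_mul (hcomp (f j) l)
  have hint : ∀ g : Lp ℝ 2 μ, Integrable (fun z => |∑ l, g (P l z) ^ 2 - ‖g‖ ^ 2|) ν := fun g =>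
    ((integrable_finsetSum _ fun l _ => (hcomp g l).integrable_sq).sub (integrable_const _)).abs
  have hentry : ∀ i j, ∫ z, |(∑ l, f i (P l z) * f j (P l z)) - if i = j then 1 else 0| ∂ν ≤
      3 * (L * ε ^ 2 + η) + ε := by
    intro i j
    have hδ : |⟪f i, f j⟫_ℝ - if i = j then 1 else 0| ≤ ε := by
      split_ifs with h
      · subst h
        rw [real_inner_self_eq_norm_sq, hnorm]; simpa using hε0.le
      · rw [sub_zero]; exact horth i j h
    have hpol : ∀ᵐ z ∂ν, |(∑ l, f i (P l z) * f j (P l z)) - if i = j then 1 else 0| ≤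
        1 / 2 * (|∑ l, (f i + f j) (P l z) ^ 2 - ‖f i + f j‖ ^ 2| +
          |∑ l, f i (P l z) ^ 2 - ‖f i‖ ^ 2| + |∑ l, f j (P l z) ^ 2 - ‖f j‖ ^ 2|) + ε := by
      filter_upwards [hP.ae_base (Lp.coeFn_add (f i) (f j))] with z hz
      have e1 : ∑ l, (f i + f j) (P l z) ^ 2 = ∑ l, f i (P l z) ^ 2 + ∑ l, f j (P l z) ^ 2 +
          2 * ∑ l, f i (P l z) * f j (P l z) := by
        rw [Finset.mul_sum, ← Finset.sum_add_distrib, ← Finset.sum_add_distrib]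
        refine Finset.sum_congr rfl fun l _ => ?_
        rw [hz l, Pi.add_apply]; ring
      have e2 : ‖f i + f j‖ ^ 2 = ‖f i‖ ^ 2 + 2 * ⟪f i, f j⟫_ℝ + ‖f j‖ ^ 2 :=
        norm_add_sq_real _ _
      rw [e1, e2]
      set x := ∑ l, f i (P l z) * f j (P l z)
      set a := ∑ l, f i (P l z) ^ 2
      set b := ∑ l, f j (P l z) ^ 2
      have e3 : |x - ⟪f i, f j⟫_ℝ| ≤ 1 / 2 * (|a + b + 2 * x -
          (‖f i‖ ^ 2 + 2 * ⟪f i, f j⟫_ℝ + ‖f j‖ ^ 2)| + |a - ‖f i‖ ^ 2| + |b - ‖f j‖ ^ 2|) := by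
        rw [abs_le]
        constructor <;> linarith [le_abs_self (a - ‖f i‖ ^ 2), neg_abs_le (a - ‖f i‖ ^ 2),
          le_abs_self (b - ‖f j‖ ^ 2), neg_abs_le (b - ‖f j‖ ^ 2),
          le_abs_self (a + b + 2 * x - (‖f i‖ ^ 2 + 2 * ⟪f i, f j⟫_ℝ + ‖f j‖ ^ 2)),
          neg_abs_le (a + b + 2 * x - (‖f i‖ ^ 2 + 2 * ⟪f i, f j⟫_ℝ + ‖f j‖ ^ 2))]
      exact (abs_sub_le _ _ _).trans (add_le_add e3 hδ)
    have hT2 : ‖T (f i + f j)‖ ^ 2 ≤ 4 * ε ^ 2 := by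
      have : ‖T (f i + f j)‖ ≤ ε + ε := by
        rw [map_add]; exact (norm_add_le _ _).trans (add_le_add (hTf i) (hTf j))
      calc ‖T (f i + f j)‖ ^ 2 ≤ (ε + ε) ^ 2 := by gcongr
        _ = 4 * ε ^ 2 := by ring
    have hN2 : ‖f i + f j‖ ^ 2 ≤ 4 := by
      have : ‖f i + f j‖ ≤ 1 + 1 := by
        refine (norm_add_le _ _).trans_eq ?_
        rw [hnorm, hnorm]
      calc ‖f i + f j‖ ^ 2 ≤ (1 + 1) ^ 2 := by gcongr
        _ = 4 := by norm_num
    have hT1 : ∀ i, ‖T (f i)‖ ^ 2 ≤ ε ^ 2 := fun i => by have := hTf i; gcongr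
    have d1 := hdev (f i + f j)
    have d2 := hdev (f i)
    have d3 := hdev (f j)
    have hb12 : Integrable (fun z => |∑ l, (f i + f j) (P l z) ^ 2 - ‖f i + f j‖ ^ 2| +
        |∑ l, f i (P l z) ^ 2 - ‖f i‖ ^ 2|) ν := (hint (f i + f j)).add (hint (f i))
    have hb : Integrable (fun z => 1 / 2 * (|∑ l, (f i + f j) (P l z) ^ 2 - ‖f i + f j‖ ^ 2| +
        |∑ l, f i (P l z) ^ 2 - ‖f i‖ ^ 2| + |∑ l, f j (P l z) ^ 2 - ‖f j‖ ^ 2|)) ν :=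
      (hb12.add (hint (f j))).const_mul (1 / 2)
    refine (integral_mono_of_nonneg (Filter.Eventually.of_forall fun z => abs_nonneg _)
      (hb.add (integrable_const ε)) hpol).trans ?_
    rw [integral_add' hb (integrable_const ε), integral_const_mul, integral_add hb12 (hint (f j)),
      integral_add (hint (f i + f j)) (hint (f i)), integral_const, probReal_univ, one_smul]
    rw [hnorm i, one_pow] at d2
    rw [hnorm j, one_pow] at d3
    rw [hnorm i, hnorm j, one_pow]
    have l1 := mul_le_mul_of_nonneg_left hT2 hL0
    have l2 := mul_le_mul_of_nonneg_left (hT1 i) hL0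
    have l3 := mul_le_mul_of_nonneg_left (hT1 j) hL0
    have l4 := mul_le_mul_of_nonneg_left hN2 hη0.le
    linarith
  have hi : ∀ i j, Integrable
      (fun z => |(∑ l, f i (P l z) * f j (P l z)) - if i = j then 1 else 0|) ν := fun i j =>
    ((hgram i j).sub (integrable_const _)).abs
  have hge : (1 : ℝ) ≤ ∫ z, ∑ i, ∑ j,
      |(∑ l, f i (P l z) * f j (P l z)) - if i = j then 1 else 0| ∂ν := by
    refine (by simp : (1 : ℝ) = ∫ _, 1 ∂ν).trans_le ?_
    refine integral_mono (integrable_const _)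
      (integrable_finsetSum _ fun i _ => integrable_finsetSum _ fun j _ => hi i j) fun z => ?_
    exact one_le_sum_abs_gram_sub (by simp [hn]) fun i l => f i (P l z)
  rw [integral_finsetSum _ fun i _ => integrable_finsetSum _ fun j _ => hi i j] at hge
  have hle : ∑ i, ∫ z, ∑ j, |(∑ l, f i (P l z) * f j (P l z)) - if i = j then 1 else 0| ∂ν ≤
      ∑ _i : Fin n, ∑ _j : Fin n, (3 * (L * ε ^ 2 + η) + ε) := by
    refine Finset.sum_le_sum fun i _ => ?_
    rw [integral_finsetSum _ fun j _ => hi i j]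
    exact Finset.sum_le_sum fun j _ => hentry i j
  simp only [Finset.sum_const, Finset.card_univ, Fintype.card_fin, nsmul_eq_mul, ← mul_assoc,
    ← sq] at hle
  linarith

end IsFiniteCover

namespace OrigamiDatum

variable (D : OrigamiDatum)

/-! ### Arrangement maps and shears -/

theorem pt_zero_left (i : Fin D.m) (y : unitInterval) : D.pt i (0, y) = D.pt (D.σ i) (1, y) :=
  Quot.sound (Glue.horizontal i y)

theorem pt_one_right (i : Fin D.m) (x : unitInterval) : D.pt i (x, 1) = D.pt (D.τ i) (x, 0) :=
  Quot.sound (Glue.vertical i x)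

theorem continuous_pt (i : Fin D.m) : Continuous (D.pt i) :=
  continuous_quot_mk.comp (by fun_prop)

/-- Up to the gluing, the square containing a point of the strip may be chosen freely among the
two closed squares that contain it. -/
theorem horArr_of_mem (i : Fin D.m) (j : ℤ) {x : ℝ} (y : unitInterval)
    (hx : x - j ∈ Set.Icc (0 : ℝ) 1) :
    D.horArr i x y = D.pt ((D.σ ^ (-j)) i) (⟨x - j, hx⟩, y) := by
  rcases eq_or_lt_of_le hx.2 with h | h
  · have hxj : x = ((j + 1 : ℤ) : ℝ) := by push_cast; linarith
    have hfl : ⌊x⌋ = j + 1 := by rw [hxj, Int.floor_intCast]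
    have hfr : Int.fract x = 0 := by rw [hxj, Int.fract_intCast]
    have e1 : (⟨x - j, hx⟩ : unitInterval) = 1 := Subtype.ext h
    have e2 : (⟨Int.fract x, Int.fract_nonneg x, (Int.fract_lt_one x).le⟩ : unitInterval) = 0 :=
      Subtype.ext hfr
    rw [horArr, e1, e2, pt_zero_left, hfl, ← Equiv.Perm.mul_apply, ← zpow_one_add]
    congr 3
    ring
  · have hfl : ⌊x⌋ = j := Int.floor_eq_iff.2 ⟨by linarith [hx.1], by linarith⟩
    simp only [horArr, hfl, Int.fract]

theorem horArr_coe (i : Fin D.m) (x y : unitInterval) : D.horArr i x y = D.pt i (x, y) := by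
  have hx : (x : ℝ) - (0 : ℤ) ∈ Set.Icc (0 : ℝ) 1 := by simp
  rw [D.horArr_of_mem i 0 y hx]
  congr
  simp

theorem horArr_zpow (i : Fin D.m) (n : ℤ) (x : ℝ) (y : unitInterval) :
    D.horArr ((D.σ ^ (-n)) i) x y = D.horArr i (x + n) y := by
  simp only [horArr, Int.floor_add_intCast, Int.fract_add_intCast, ← Equiv.Perm.mul_apply,
    ← zpow_add]
  congr 3
  ring

theorem continuous_horArr (i : Fin D.m) :
    Continuous fun p : ℝ × unitInterval => D.horArr i p.1 p.2 := by
  -- On each of the closed strips `[j, j + 1] × [0, 1]`, the map is a translation onto a square.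
  have hlf : LocallyFinite fun j : ℤ => (Set.Icc (j : ℝ) (j + 1)) :=
    locallyFinite_Icc_of_tendsto tendsto_intCast_atTop_atTop
      (Filter.tendsto_atBot_add_const_right _ _ (tendsto_intCast_atBot_iff.2 Filter.tendsto_id))
  refine (hlf.preimage_continuous (continuous_fst (X := ℝ) (Y := unitInterval))).continuous ?_
    (fun j => isClosed_Icc.preimage continuous_fst) fun j => ?_
  · refine Set.eq_univ_of_forall fun p => Set.mem_iUnion.2 ⟨⌊p.1⌋, ?_⟩
    exact ⟨Int.floor_le _, (Int.lt_floor_add_one _).le⟩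
  · let g : ℝ × unitInterval → D.Surface := fun p =>
      D.pt ((D.σ ^ (-j)) i) (Set.projIcc 0 1 zero_le_one (p.1 - j), p.2)
    have hg : Continuous g := (D.continuous_pt _).comp (by fun_prop)
    refine hg.continuousOn.congr fun p hp => ?_
    have hx : p.1 - j ∈ Set.Icc (0 : ℝ) 1 := ⟨by linarith [hp.1], by linarith [hp.2]⟩
    change D.horArr i p.1 p.2 = g p
    rw [D.horArr_of_mem i j p.2 hx]
    simp only [g, Set.projIcc_of_mem zero_le_one hx]

/-- The horizontal shear of the surface, which is given on the square `i` by the matrix `(1 c; 0 1)`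
followed by the horizontal arrangement map. -/
def horShear (c : ℤ) (hc : D.σ ^ c = 1) : D.Surface → D.Surface :=
  Quot.lift (fun q => D.horArr q.1 (q.2.1 + c * q.2.2) q.2.2) (by
    have hc' : D.σ ^ (-c) = 1 := by rw [zpow_neg, hc, inv_one]
    rintro _ _ (⟨i, y⟩ | ⟨i, x⟩)
    · have := D.horArr_zpow (D.σ i) 1 (0 + c * y) y
      have h : (D.σ ^ (-1 : ℤ)) (D.σ i) = i := by
        rw [zpow_neg_one]; exact D.σ.symm_apply_apply i
      rw [h] at this
      simpa [add_comm] using this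
    · have h1 := D.horArr_zpow i c x 1
      rw [hc', Equiv.Perm.one_apply, horArr_coe, pt_one_right] at h1
      simp [← h1, horArr_coe])

theorem horShear_pt (c : ℤ) (hc : D.σ ^ c = 1) (i : Fin D.m) (p : unitInterval × unitInterval) :
    D.horShear c hc (D.pt i p) = D.horArr i (p.1 + c * p.2) p.2 := rfl

theorem horShear_horArr (c : ℤ) (hc : D.σ ^ c = 1) (i : Fin D.m) (x : ℝ) (y : unitInterval) :
    D.horShear c hc (D.horArr i x y) = D.horArr i (x + c * y) y := by
  rw [horArr, horShear_pt, horArr_zpow]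
  congr 1
  simp only [Int.fract]
  ring

theorem continuous_horShear (c : ℤ) (hc : D.σ ^ c = 1) : Continuous (D.horShear c hc) := by
  refine continuous_quot_lift _ ?_
  refine continuous_prod_of_discrete_left.2 fun i => ?_
  exact (D.continuous_horArr i).comp (f := fun p : unitInterval × unitInterval =>
    ((p.1 + c * p.2 : ℝ), p.2)) (by fun_prop)

theorem horShear_horShear (c c' : ℤ) (hc : D.σ ^ c = 1) (hc' : D.σ ^ c' = 1) (h : c + c' = 0)
    (x : D.Surface) : D.horShear c hc (D.horShear c' hc' x) = x := by
  induction x using Quot.ind with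
  | mk q =>
    obtain ⟨i, p⟩ := q
    change D.horShear c hc (D.horShear c' hc' (D.pt i p)) = D.pt i p
    rw [horShear_pt, horShear_horArr, add_assoc, ← add_mul, add_comm (c' : ℝ), ← Int.cast_add, h,
      Int.cast_zero, zero_mul, add_zero, horArr_coe]

/-- The horizontal shear as a homeomorphism. -/
def horShearHomeo (c : ℤ) (hc : D.σ ^ c = 1) : D.Surface ≃ₜ D.Surface where
  toFun := D.horShear c hc
  invFun := D.horShear (-c) (by rw [zpow_neg, hc, inv_one])
  left_inv := D.horShear_horShear _ _ _ _ (neg_add_cancel c)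
  right_inv := D.horShear_horShear _ _ _ _ (add_neg_cancel c)
  continuous_toFun := D.continuous_horShear _ _
  continuous_invFun := D.continuous_horShear _ _

/-- The origami datum obtained by exchanging the two coordinates. The inverses are due to the
convention that `σ` points to the left, while `τ` points upwards. -/
def swap : OrigamiDatum where
  m := D.m
  m_pos := D.m_pos
  σ := D.τ⁻¹
  τ := D.σ⁻¹
  transitive i j := by
    obtain ⟨g, hg, h⟩ := D.transitive i j
    refine ⟨g, ?_, h⟩
    have hle : Subgroup.closure {D.σ, D.τ} ≤ Subgroup.closure {D.τ⁻¹, D.σ⁻¹} := by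
      rw [Subgroup.closure_le]
      rintro _ (rfl | rfl)
      · exact (Subgroup.inv_mem_iff _).1 (Subgroup.subset_closure (by simp))
      · exact (Subgroup.inv_mem_iff _).1 (Subgroup.subset_closure (by simp))
    exact hle hg

/-- Exchanging the coordinates identifies the surfaces of `D` and `D.swap`. -/
def swapHomeo : D.Surface ≃ₜ D.swap.Surface where
  toFun := Quot.lift (fun q => D.swap.pt q.1 q.2.swap) (by
    rintro _ _ (⟨i, y⟩ | ⟨i, x⟩)
    · have h := D.swap.pt_one_right (D.σ i) y
      rw [show D.swap.τ (D.σ i) = i from D.σ.symm_apply_apply i] at h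
      exact h.symm
    · have h := D.swap.pt_zero_left (D.τ i) x
      rw [show D.swap.σ (D.τ i) = i from D.τ.symm_apply_apply i] at h
      exact h.symm)
  invFun := Quot.lift (fun q => D.pt q.1 q.2.swap) (by
    rintro _ _ (⟨i, y⟩ | ⟨i, x⟩)
    · have := D.pt_one_right (D.τ⁻¹ i) y
      rw [show D.τ (D.τ⁻¹ i) = i from D.τ.apply_symm_apply i] at this
      exact this.symm
    · have := D.pt_zero_left (D.σ⁻¹ i) x
      rw [show D.σ (D.σ⁻¹ i) = i from D.σ.apply_symm_apply i] at this
      exact this.symm)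
  left_inv x := by induction x using Quot.ind; rfl
  right_inv x := by induction x using Quot.ind; rfl
  continuous_toFun := continuous_quot_lift _ <|
    continuous_prod_of_discrete_left.2 fun i => (D.swap.continuous_pt i).comp continuous_swap
  continuous_invFun := continuous_quot_lift _ <|
    continuous_prod_of_discrete_left.2 fun i => (D.continuous_pt i).comp continuous_swap

theorem swapHomeo_symm_horArr (i : Fin D.m) (x : ℝ) (y : unitInterval) :
    D.swapHomeo.symm (D.swap.horArr i x y) = D.verArr i y x := by
  have : D.swap.σ ^ (-⌊x⌋) = D.τ ^ ⌊x⌋ := by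
    change D.τ⁻¹ ^ (-⌊x⌋) = _
    rw [inv_zpow', neg_neg]
  unfold horArr verArr
  rw [this]; rfl

theorem swap_zpow {c : ℤ} (hc : D.τ ^ c = 1) : D.swap.σ ^ c = 1 := by
  change D.τ⁻¹ ^ c = 1
  rw [inv_zpow, hc, inv_one]

/-- The vertical shear as a homeomorphism: the horizontal shear after exchanging coordinates. -/
def verShearHomeo (c : ℤ) (hc : D.τ ^ c = 1) : D.Surface ≃ₜ D.Surface :=
  (D.swapHomeo.trans (D.swap.horShearHomeo c (D.swap_zpow hc))).trans D.swapHomeo.symm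

theorem horShearHomeo_pt (c : ℤ) (hc : D.σ ^ c = 1) (i : Fin D.m)
    (p : unitInterval × unitInterval) :
    D.horShearHomeo c hc (D.pt i p) = D.horArr i (p.1 + c * p.2) p.2 := rfl

theorem verShearHomeo_pt (c : ℤ) (hc : D.τ ^ c = 1) (i : Fin D.m)
    (p : unitInterval × unitInterval) :
    D.verShearHomeo c hc (D.pt i p) = D.verArr i p.1 (c * p.1 + p.2) := by
  change D.swapHomeo.symm (D.swap.horArr i (p.2 + c * p.1) p.1) = _
  rw [swapHomeo_symm_horArr, add_comm]

/-! ### The projection to the torus -/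

theorem toTorus_pt (i : Fin D.m) (p : unitInterval × unitInterval) :
    D.toTorus (D.pt i p) = torusProj (p.1, p.2) := rfl

theorem toTorus_horArr (i : Fin D.m) (x : ℝ) (y : unitInterval) :
    D.toTorus (D.horArr i x y) = torusProj (x, y) := by
  rw [horArr, toTorus_pt]; simp [torusProj]

theorem toTorus_verArr (i : Fin D.m) (x : unitInterval) (y : ℝ) :
    D.toTorus (D.verArr i x y) = torusProj (x, y) := by
  rw [verArr, toTorus_pt]; simp [torusProj]

theorem torusAct_torusProj (A : Matrix.SpecialLinearGroup (Fin 2) ℤ) (v : ℝ × ℝ) :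
    torusAct A (torusProj v) = torusProj (planeAct A v) := by
  have h : ∀ (n : ℤ) (x : ℝ), n • (x : UnitAddCircle) = ((n * x : ℝ) : UnitAddCircle) := by
    intro n x
    rw [← AddCircle.coe_zsmul, zsmul_eq_mul]
  simp only [torusAct, torusProj, planeAct, h, AddCircle.coe_add]

theorem torusProj_add (v w : ℝ × ℝ) : torusProj (v + w) = torusProj v + torusProj w := rfl

theorem exists_int_of_torusProj_eq_zero {v : ℝ × ℝ} (h : torusProj v = 0) :
    ∃ n : ℤ × ℤ, v = ((n.1 : ℝ), (n.2 : ℝ)) := by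
  have h1 : (v.1 : UnitAddCircle) = 0 := congrArg Prod.fst h
  have h2 : (v.2 : UnitAddCircle) = 0 := congrArg Prod.snd h
  rw [AddCircle.coe_eq_zero_iff] at h1 h2
  obtain ⟨n, hn⟩ := h1
  obtain ⟨n', hn'⟩ := h2
  exact ⟨(n, n'), Prod.ext (by simpa using hn.symm) (by simpa using hn'.symm)⟩

/-- A homeomorphism covering the linear action of `A` on the torus is affine with linear part `A`:
in charts, its difference from `A` is continuous with values in `ℤ²`. -/
theorem isAffineWith_of_toTorus {f : D.Surface ≃ₜ D.Surface}
    {A : Matrix.SpecialLinearGroup (Fin 2) ℤ}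
    (h : ∀ x, D.toTorus (f x) = torusAct A (D.toTorus x)) : D.IsAffineWith f A := by
  intro e e' he he' x hx hfx
  let d : D.Surface → ℝ × ℝ := fun y => e' (f y) - planeAct A (e y)
  have hsrc : ∀ᶠ y in 𝓝 x, y ∈ e.source ∧ f y ∈ e'.source :=
    Filter.Eventually.and (e.open_source.mem_nhds hx)
      (f.continuous.continuousAt.preimage_mem_nhds (e'.open_source.mem_nhds hfx))
  have hdproj : ∀ y, y ∈ e.source ∧ f y ∈ e'.source → torusProj (d y) = 0 := by
    rintro y ⟨hy, hfy⟩
    have h1 : torusProj (d y) + torusProj (planeAct A (e y)) = torusProj (e' (f y)) := by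
      rw [← torusProj_add]; simp [d]
    rw [he' _ hfy, h, ← he _ hy, torusAct_torusProj] at h1
    exact add_eq_right.1 h1
  have hplane : Continuous (planeAct A) := by unfold planeAct; fun_prop
  have hd : ContinuousAt d x :=
    ((e'.continuousAt hfx).comp f.continuous.continuousAt).sub
      (hplane.continuousAt.comp (e.continuousAt hx))
  refine ⟨d x, ?_⟩
  filter_upwards [hsrc, hd.eventually (Metric.ball_mem_nhds (d x) one_pos)] with y hy hball
  have hdy : d y = d x := by
    obtain ⟨n, hn⟩ := exists_int_of_torusProj_eq_zero (hdproj y hy)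
    obtain ⟨n', hn'⟩ := exists_int_of_torusProj_eq_zero (hdproj x ⟨hx, hfx⟩)
    rw [hn, hn'] at hball ⊢
    rw [Prod.dist_eq, max_lt_iff] at hball
    simp only [Real.dist_eq] at hball
    have h1 : |n.1 - n'.1| < 1 := by exact_mod_cast hball.1
    have h2 : |n.2 - n'.2| < 1 := by exact_mod_cast hball.2
    rw [Int.abs_lt_one_iff, sub_eq_zero] at h1 h2
    rw [h1, h2]
  rw [← hdy]
  simp [d]

/-! ### Lipschitz continuity of the shears -/

theorem squareDist_nonneg (p q : unitInterval × unitInterval) : 0 ≤ squareDist p q :=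
  Real.sqrt_nonneg _

theorem squareDist_comm (p q : unitInterval × unitInterval) : squareDist p q = squareDist q p := by
  unfold squareDist; congr 1; ring

theorem squareDist_swap (p q : unitInterval × unitInterval) :
    squareDist p.swap q.swap = squareDist p q := by
  unfold squareDist; rw [add_comm]; rfl

variable {D} in
theorem ChainLength.nonneg {x y : D.Surface} {ℓ : ℝ} (h : D.ChainLength x y ℓ) : 0 ≤ ℓ := by
  induction h with
  | nil => exact le_rfl
  | cons i p q y ℓ _ ih => exact add_nonneg (squareDist_nonneg p q) ih

variable {D} in
theorem ChainLength.trans {x y z : D.Surface} {ℓ ℓ' : ℝ} (h : D.ChainLength x y ℓ)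
    (h' : D.ChainLength y z ℓ') : D.ChainLength x z (ℓ + ℓ') := by
  induction h with
  | nil => simpa using h'
  | cons i p q y ℓ _ ih => rw [add_assoc]; exact ChainLength.cons i p q z _ (ih h')

theorem chainLength_pt (i : Fin D.m) (p q : unitInterval × unitInterval) :
    D.ChainLength (D.pt i p) (D.pt i q) (squareDist p q) := by
  simpa using ChainLength.cons i p q _ 0 (ChainLength.nil _)

variable {D} in
theorem ChainLength.symm {x y : D.Surface} {ℓ : ℝ} (h : D.ChainLength x y ℓ) :
    D.ChainLength y x ℓ := by
  induction h with
  | nil => exact ChainLength.nil _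
  | cons i p q y ℓ _ ih =>
    rw [add_comm, squareDist_comm]
    exact ih.trans (D.chainLength_pt i q p)

theorem flatDist_le {x y : D.Surface} {ℓ : ℝ} (h : D.ChainLength x y ℓ) :
    D.flatDist x y ≤ ENNReal.ofReal ℓ := iInf₂_le ℓ h

theorem flatDist_self (x : D.Surface) : D.flatDist x x = 0 := by
  simpa using D.flatDist_le (ChainLength.nil x)

theorem flatDist_comm (x y : D.Surface) : D.flatDist x y = D.flatDist y x :=
  le_antisymm (le_iInf₂ fun _ h => D.flatDist_le h.symm) (le_iInf₂ fun _ h => D.flatDist_le h.symm)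

theorem flatDist_triangle (x y z : D.Surface) :
    D.flatDist x z ≤ D.flatDist x y + D.flatDist y z := by
  conv_rhs => unfold flatDist
  simp only [ENNReal.iInf_add, ENNReal.add_iInf]
  exact le_iInf₂ fun ℓ' hℓ' => le_iInf₂ fun ℓ hℓ =>
    (D.flatDist_le (hℓ.trans hℓ')).trans ENNReal.ofReal_add_le

theorem flatDist_pt_le (i : Fin D.m) (p q : unitInterval × unitInterval) :
    D.flatDist (D.pt i p) (D.pt i q) ≤ ENNReal.ofReal (squareDist p q) :=
  D.flatDist_le (D.chainLength_pt i p q)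

/-- For the flat metric, Lipschitz continuity can be checked on each square. -/
theorem flatDist_map_le {D D' : OrigamiDatum} {f : D.Surface → D'.Surface} {K : ℝ≥0} (hK : K ≠ 0)
    (h : ∀ i p q, D'.flatDist (f (D.pt i p)) (f (D.pt i q)) ≤ K * ENNReal.ofReal (squareDist p q))
    (x y : D.Surface) : D'.flatDist (f x) (f y) ≤ K * D.flatDist x y := by
  have hchain : ∀ {x y ℓ}, D.ChainLength x y ℓ →
      D'.flatDist (f x) (f y) ≤ K * ENNReal.ofReal ℓ := by
    intro x y ℓ hℓ
    induction hℓ with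
    | nil x => simp [flatDist_self]
    | cons i p q y ℓ hℓ ih =>
      rw [ENNReal.ofReal_add (squareDist_nonneg p q) hℓ.nonneg, mul_add]
      exact (D'.flatDist_triangle _ _ _).trans (add_le_add (h i p q) ih)
  have hK' : (K : ℝ≥0∞) ≠ 0 := by exact_mod_cast hK
  rw [flatDist.eq_def D x y, ENNReal.mul_iInf_of_ne hK' ENNReal.coe_ne_top]
  refine le_iInf fun ℓ => ?_
  rw [ENNReal.mul_iInf_of_ne hK' ENNReal.coe_ne_top]
  exact le_iInf fun hℓ => hchain hℓ

theorem flatDist_horArr_snd_le (i : Fin D.m) (x : ℝ) (y y' : unitInterval) :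
    D.flatDist (D.horArr i x y) (D.horArr i x y') ≤ ENNReal.ofReal |(y : ℝ) - y'| := by
  refine (D.flatDist_pt_le _ _ _).trans_eq ?_
  simp [squareDist, Real.sqrt_sq_eq_abs]

theorem flatDist_horArr_fst_le_of_mem (i : Fin D.m) {j : ℤ} {x x' : ℝ} (y : unitInterval)
    (hx : x - j ∈ Set.Icc (0 : ℝ) 1) (hx' : x' - j ∈ Set.Icc (0 : ℝ) 1) :
    D.flatDist (D.horArr i x y) (D.horArr i x' y) ≤ ENNReal.ofReal |x - x'| := by
  rw [D.horArr_of_mem i j y hx, D.horArr_of_mem i j y hx']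
  refine (D.flatDist_pt_le _ _ _).trans_eq ?_
  simp [squareDist, Real.sqrt_sq_eq_abs]

/-- The distance between two points of a horizontal line is bounded by the length of the segment
between them, which is cut into pieces at the sides of the squares. -/
theorem flatDist_horArr_fst_le (i : Fin D.m) (x x' : ℝ) (y : unitInterval) :
    D.flatDist (D.horArr i x y) (D.horArr i x' y) ≤ ENNReal.ofReal |x - x'| := by
  have key : ∀ (n : ℕ) (x x' : ℝ), x ≤ x' → x' ≤ ⌊x⌋ + 1 + n →
      D.flatDist (D.horArr i x y) (D.horArr i x' y) ≤ ENNReal.ofReal (x' - x) := by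
    intro n
    induction n with
    | zero =>
      intro x x' h h'
      have h1 := Int.floor_le x
      have h2 := Int.lt_floor_add_one x
      rw [Nat.cast_zero, add_zero] at h'
      rw [← abs_of_nonneg (sub_nonneg.2 h), abs_sub_comm]
      exact D.flatDist_horArr_fst_le_of_mem i (j := ⌊x⌋) y ⟨by linarith, by linarith⟩
        ⟨by linarith, by linarith⟩
    | succ n ih =>
      intro x x' h h'
      rcases le_or_gt x' (⌊x⌋ + 1) with hle | hlt
      · exact ih x x' h (by linarith [(n.cast_nonneg : (0 : ℝ) ≤ n)])
      · have h1 := Int.floor_le x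
        have h2 := Int.lt_floor_add_one x
        have e1 : D.flatDist (D.horArr i x y) (D.horArr i (⌊x⌋ + 1) y) ≤
            ENNReal.ofReal (⌊x⌋ + 1 - x) := by
          rw [← abs_of_nonneg (by linarith : (0 : ℝ) ≤ ⌊x⌋ + 1 - x), abs_sub_comm]
          exact D.flatDist_horArr_fst_le_of_mem i (j := ⌊x⌋) y ⟨by linarith, by linarith⟩
            ⟨by linarith, by linarith⟩
        have e2 := ih (⌊x⌋ + 1) x' hlt.le (by
          rw [Int.floor_add_one, Int.floor_intCast]; push_cast at h' ⊢; linarith)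
        refine (D.flatDist_triangle _ _ _).trans ((add_le_add e1 e2).trans_eq ?_)
        rw [← ENNReal.ofReal_add (by linarith) (by linarith)]
        congr 1; ring
  have hn : ∀ x x' : ℝ, ∃ n : ℕ, x' ≤ ⌊x⌋ + 1 + n := fun x x' => by
    obtain ⟨n, hn⟩ := exists_nat_ge (x' - (⌊x⌋ + 1))
    exact ⟨n, by linarith⟩
  rcases le_total x x' with h | h
  · obtain ⟨n, hn⟩ := hn x x'
    rw [abs_sub_comm, abs_of_nonneg (sub_nonneg.2 h)]
    exact key n x x' h hn
  · obtain ⟨n, hn⟩ := hn x' x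
    rw [flatDist_comm, abs_of_nonneg (sub_nonneg.2 h)]
    exact key n x' x h hn

theorem flatDist_horShear_le (c : ℤ) (hc : D.σ ^ c = 1) (x y : D.Surface) :
    D.flatDist (D.horShear c hc x) (D.horShear c hc y) ≤
      ((c.natAbs + 2 : ℕ) : ℝ≥0) * D.flatDist x y := by
  refine flatDist_map_le (Nat.cast_ne_zero.2 (Nat.succ_ne_zero _)) (fun i p q => ?_) x y
  rw [horShear_pt, horShear_pt]
  have h1 : |(p.1 : ℝ) - q.1| ≤ squareDist p q := by
    rw [squareDist]; exact Real.abs_le_sqrt (by nlinarith [sq_nonneg ((p.2 : ℝ) - q.2)])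
  have h2 : |(p.2 : ℝ) - q.2| ≤ squareDist p q := by
    rw [squareDist]; exact Real.abs_le_sqrt (by nlinarith [sq_nonneg ((p.1 : ℝ) - q.1)])
  have h3 : |(p.1 + c * p.2 : ℝ) - (q.1 + c * q.2)| ≤ (1 + |(c : ℝ)|) * squareDist p q := by
    have : (p.1 + c * p.2 : ℝ) - (q.1 + c * q.2) = (p.1 - q.1) + c * (p.2 - q.2) := by ring
    rw [this]
    refine (abs_add_le _ _).trans ?_
    rw [abs_mul, add_mul, one_mul]
    gcongr
  refine (D.flatDist_triangle _ (D.horArr i (q.1 + c * q.2) p.2) _).trans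
    ((add_le_add (D.flatDist_horArr_fst_le _ _ _ _) (D.flatDist_horArr_snd_le _ _ _ _)).trans ?_)
  have hK : (((c.natAbs + 2 : ℕ) : ℝ≥0) : ℝ≥0∞) = ENNReal.ofReal (|(c : ℝ)| + 2) := by
    have h : |(c : ℝ)| + 2 = ((c.natAbs + 2 : ℕ) : ℝ) := by
      rw [← Int.cast_abs, Int.abs_eq_natAbs, Int.cast_natCast]; push_cast; rfl
    rw [h, ENNReal.ofReal_natCast, ENNReal.coe_natCast]
  rw [hK, ← ENNReal.ofReal_mul (by positivity),
    ← ENNReal.ofReal_add (by positivity) (by positivity)]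
  exact ENNReal.ofReal_le_ofReal (by linarith)

/-- `f` is Lipschitz for the flat metric. -/
def IsFlatLipschitz (f : D.Surface → D.Surface) : Prop :=
  ∃ K : ℝ≥0, ∀ x y, D.flatDist (f x) (f y) ≤ K * D.flatDist x y

variable {D} in
theorem IsFlatLipschitz.comp {f g : D.Surface → D.Surface} (hf : D.IsFlatLipschitz f)
    (hg : D.IsFlatLipschitz g) : D.IsFlatLipschitz (f ∘ g) := by
  obtain ⟨K, hK⟩ := hf
  obtain ⟨K', hK'⟩ := hg
  refine ⟨K * K', fun x y => (hK _ _).trans ?_⟩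
  rw [ENNReal.coe_mul, mul_assoc]
  exact mul_le_mul_right (hK' x y) _

theorem isFlatLipschitz_horShearHomeo (c : ℤ) (hc : D.σ ^ c = 1) :
    D.IsFlatLipschitz (D.horShearHomeo c hc) := ⟨_, D.flatDist_horShear_le c hc⟩

theorem isFlatLipschitz_verShearHomeo (c : ℤ) (hc : D.τ ^ c = 1) :
    D.IsFlatLipschitz (D.verShearHomeo c hc) := by
  have h1 : ∀ x y, D.swap.flatDist (D.swapHomeo x) (D.swapHomeo y) ≤ D.flatDist x y := by
    intro x y
    simpa using flatDist_map_le (f := D.swapHomeo) one_ne_zero (fun i p q => by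
      rw [ENNReal.coe_one, one_mul, ← squareDist_swap]
      exact D.swap.flatDist_pt_le i _ _) x y
  have h2 : ∀ x y, D.flatDist (D.swapHomeo.symm x) (D.swapHomeo.symm y) ≤ D.swap.flatDist x y := by
    intro x y
    simpa using flatDist_map_le (f := D.swapHomeo.symm) one_ne_zero (fun i p q => by
      rw [ENNReal.coe_one, one_mul, ← squareDist_swap]
      exact D.flatDist_pt_le i _ _) x y
  refine ⟨((c.natAbs + 2 : ℕ) : ℝ≥0), fun x y => (h2 _ _).trans
    ((D.swap.flatDist_horShear_le c (D.swap_zpow hc) _ _).trans ?_)⟩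
  exact mul_le_mul_right (h1 x y) _

/-! ### The area measure -/

/-- The representative in `[0, 1]` of a point of the circle. -/
def circleRep (x : UnitAddCircle) : unitInterval :=
  ⟨AddCircle.equivIco 1 0 x, by
    have := (AddCircle.equivIco (1 : ℝ) 0 x).2
    exact ⟨this.1, this.2.le.trans_eq (zero_add 1)⟩⟩

theorem circleRep_coe (t : ℝ) : (circleRep t : ℝ) = Int.fract t := by
  change ((AddCircle.equivIco (1 : ℝ) 0 (t : UnitAddCircle)) : ℝ) = _
  rw [AddCircle.coe_equivIco_mk_apply]; simp

theorem coe_circleRep (x : UnitAddCircle) : ((circleRep x : ℝ) : UnitAddCircle) = x :=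
  (AddCircle.equivIco 1 0).symm_apply_apply x

theorem measurable_circleRep : Measurable circleRep :=
  Measurable.subtype_mk ((AddCircle.measurableEquivIco 1 0).measurable.subtype_val)

theorem measurePreserving_circleRep : MeasurePreserving circleRep := by
  have hmk : MeasurePreserving (fun t : unitInterval => ((t : ℝ) : UnitAddCircle)) := by
    have h1 : MeasurePreserving ((↑) : unitInterval → ℝ) volume
        (volume.restrict (Set.Icc (0 : ℝ) 1)) :=
      measurePreserving_subtype_coe measurableSet_Icc
    have h2 := UnitAddCircle.measurePreserving_mk 0
    rw [zero_add, Measure.restrict_congr_set Ioc_ae_eq_Icc] at h2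
    exact h2.comp h1
  refine ⟨measurable_circleRep, ?_⟩
  rw [← hmk.map_eq, Measure.map_map measurable_circleRep hmk.measurable]
  have hae : (circleRep ∘ fun t : unitInterval => ((t : ℝ) : UnitAddCircle)) =ᵐ[volume] id := by
    have h1 : ∀ᵐ t : unitInterval, t ≠ 1 := by
      rw [ae_iff]; simp
    filter_upwards [h1] with t ht
    refine Subtype.ext ?_
    rw [Function.comp, circleRep_coe, id, Int.fract_eq_self]
    exact ⟨t.2.1, lt_of_le_of_ne t.2.2 fun h => ht (Subtype.ext h)⟩
  rw [Measure.map_congr hae, Measure.map_id]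

/-- The point of the square `i` over a point of the torus. -/
def fiberPt (i : Fin D.m) (z : Torus) : D.Surface := D.pt i (circleRep z.1, circleRep z.2)

/-- The half-open squares exhibit the surface as an `m`-fold cover of the torus. -/
theorem isFiniteCover_fiberPt : IsFiniteCover D.fiberPt volume D.area := by
  have hs : MeasurePreserving (Prod.map circleRep circleRep) (volume : Measure Torus) volume :=
    measurePreserving_circleRep.prod measurePreserving_circleRep
  refine ⟨fun i => (D.continuous_pt i).measurable.comp hs.measurable, ?_⟩
  unfold area
  congr 1
  ext1 i
  rw [← hs.map_eq, Measure.map_map (D.continuous_pt i).measurable hs.measurable]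
  rfl

theorem liftsAlong_horShearHomeo (k : ℕ) (hc : D.σ ^ (k : ℤ) = 1) :
    LiftsAlong D.fiberPt (D.horShearHomeo k hc) (torusAct (matA k)) := by
  intro z
  refine ⟨D.σ ^ (-⌊(circleRep z.1 + (k : ℤ) * circleRep z.2 : ℝ)⌋), fun i => ?_⟩
  rw [fiberPt, horShearHomeo_pt, horArr, fiberPt]
  have h1 : (torusAct (matA k) z).1 =
      ((circleRep z.1 + (k : ℤ) * circleRep z.2 : ℝ) : UnitAddCircle) := by
    rw [AddCircle.coe_add, ← zsmul_eq_mul, AddCircle.coe_zsmul, coe_circleRep, coe_circleRep]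
    simp [torusAct, matA]
  have h2 : (torusAct (matA k) z).2 = z.2 := by simp [torusAct, matA]
  congr 2
  · refine Subtype.ext ?_
    rw [h1, circleRep_coe]
  · rw [h2]

theorem liftsAlong_verShearHomeo (k : ℕ) (hc : D.τ ^ (k : ℤ) = 1) :
    LiftsAlong D.fiberPt (D.verShearHomeo k hc) (torusAct (matB k)) := by
  intro z
  refine ⟨D.τ ^ ⌊((k : ℤ) * circleRep z.1 + circleRep z.2 : ℝ)⌋, fun i => ?_⟩
  rw [fiberPt, verShearHomeo_pt, verArr, fiberPt]
  have h1 : (torusAct (matB k) z).2 =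
      (((k : ℤ) * circleRep z.1 + circleRep z.2 : ℝ) : UnitAddCircle) := by
    rw [AddCircle.coe_add, ← zsmul_eq_mul, AddCircle.coe_zsmul, coe_circleRep, coe_circleRep]
    simp [torusAct, matB]
  have h2 : (torusAct (matB k) z).1 = z.1 := by simp [torusAct, matB]
  congr 2
  · rw [h2]
  · refine Subtype.ext ?_
    rw [h1, circleRep_coe]

end OrigamiDatum

/-! ### Ergodicity of the action on the surface -/

/-- Ergodicity of irrational rotations, for periodic functions on the line. -/
theorem exists_ae_eq_const_of_periodic {g : ℝ → ℝ} (hg : Measurable g) {p : ℝ} (hp : 0 < p)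
    (hper : Function.Periodic g p) {a : ℝ} (ha : Irrational (a / p))
    (h : ∀ᵐ t, g (a + t) = g t) :
    ∃ C, ∀ s, ∀ᵐ t ∂volume.restrict (Set.Ioc s (s + p)), g t = C := by
  have : Fact (0 < p) := ⟨hp⟩
  let G : AddCircle p → ℝ := hper.lift
  have hGm : Measurable G := by
    have : G = fun z => g (AddCircle.measurableEquivIco p 0 z) := by
      funext z
      conv_lhs => rw [← (AddCircle.equivIco p 0).symm_apply_apply z]
      rfl
    rw [this]
    exact hg.comp (AddCircle.measurableEquivIco p 0).measurable.subtype_val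
  have hord : addOrderOf (a : AddCircle p) = 0 := by
    rw [addOrderOf_eq_zero_iff, AddCircle.isOfFinAddOrder_iff_exists_rat_eq_div]
    rintro ⟨q, hq⟩
    exact ha ⟨q, hq⟩
  have hinv : (G ∘ fun z => (a : AddCircle p) + z) =ᵐ[volume] G := by
    change ∀ᵐ z, G ((a : AddCircle p) + z) = G z
    have hset : MeasurableSet {z | G ((a : AddCircle p) + z) = G z} :=
      measurableSet_eq_fun (hGm.comp (measurable_const_add _)) hGm
    rw [← (AddCircle.measurePreserving_mk p 0).map_eq,
      ae_map_iff (AddCircle.measurePreserving_mk p 0).measurable.aemeasurable hset]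
    exact ae_restrict_of_ae h
  obtain ⟨C, hC⟩ := (AddCircle.ergodic_add_left.2 hord).ae_eq_const_of_ae_eq_comp₀
    hGm.nullMeasurable hinv
  exact ⟨C, fun s => (AddCircle.measurePreserving_mk p s).quasiMeasurePreserving.ae hC⟩

theorem ae_unitInterval_iff {p : ℝ → Prop} :
    (∀ᵐ x : unitInterval, p x) ↔ ∀ᵐ x ∂volume.restrict (Set.Icc (0 : ℝ) 1), p x :=
  (ae_restrict_iff_subtype measurableSet_Icc).symm

/-- A property of real numbers holds almost everywhere if it does so on all the intervals
`[j, j + 1]`, with `j` an integer. -/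
theorem ae_of_forall_int_add {p : ℝ → Prop} (h : ∀ j : ℤ, ∀ᵐ x : unitInterval, p (x + j)) :
    ∀ᵐ t, p t := by
  have h1 : ∀ j : ℤ, ∀ᵐ t : ℝ, t - j ∈ Set.Icc (0 : ℝ) 1 → p t := by
    intro j
    have := (ae_restrict_iff' measurableSet_Icc).1
      (ae_unitInterval_iff (p := fun x => p (x + j)).1 (h j))
    have h2 := (measurePreserving_sub_right volume (j : ℝ)).quasiMeasurePreserving.ae this
    simpa using h2
  filter_upwards [ae_all_iff.2 h1] with t ht
  exact ht ⌊t⌋ ⟨by linarith [Int.floor_le t], by linarith [Int.lt_floor_add_one t]⟩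

theorem ae_unitInterval_add_of_Ioc {p : ℝ → Prop} {c s : ℝ} (hc : 1 ≤ c)
    (h : ∀ᵐ t ∂volume.restrict (Set.Ioc s (s + c)), p t) : ∀ᵐ x : unitInterval, p (x + s) := by
  rw [ae_unitInterval_iff (p := fun x => p (x + s)), ← Measure.restrict_congr_set Ioc_ae_eq_Icc,
    ae_restrict_iff' measurableSet_Ioc]
  rw [ae_restrict_iff' measurableSet_Ioc] at h
  filter_upwards [(measurePreserving_add_right volume s).quasiMeasurePreserving.ae h] with x hx hx'
  exact hx ⟨by linarith [hx'.1], by linarith [hx'.2]⟩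

theorem ae_irrational : ∀ᵐ y : unitInterval, Irrational (y : ℝ) := by
  rw [ae_unitInterval_iff (p := Irrational)]
  refine ae_restrict_of_ae ?_
  rw [ae_iff]
  simp only [Irrational, not_not]
  exact (Set.countable_range _).measure_zero _

/-- A function on a product which is constant on almost every horizontal and almost every vertical
line is constant almost everywhere. -/
theorem ae_prod_const {X Y : Type*} [MeasurableSpace X] [MeasurableSpace Y] {μ : Measure X}
    {ν : Measure Y} [IsProbabilityMeasure μ] [IsProbabilityMeasure ν] {g : X × Y → ℝ}
    (hg : Measurable g) (h : ∀ᵐ y ∂ν, ∃ C, ∀ᵐ x ∂μ, g (x, y) = C)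
    (h' : ∀ᵐ x ∂μ, ∃ C, ∀ᵐ y ∂ν, g (x, y) = C) : ∃ d, ∀ᵐ y ∂ν, ∀ᵐ x ∂μ, g (x, y) = d := by
  -- On almost every horizontal line, the value of `g` is its mean on that line.
  let c : Y → ℝ := fun y => ∫ x, g (x, y) ∂μ
  have hc : Measurable c := by
    have h1 : StronglyMeasurable (fun q : Y × X => g (q.2, q.1)) :=
      (hg.comp measurable_swap).stronglyMeasurable
    exact h1.integral_prod_right.measurable
  have h1 : ∀ᵐ y ∂ν, ∀ᵐ x ∂μ, g (x, y) = c y := by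
    filter_upwards [h] with y ⟨C, hC⟩
    have : c y = C := by
      change ∫ x, g (x, y) ∂μ = C
      rw [integral_congr_ae hC]; simp
    rwa [this]
  have h2 : ∀ᵐ x ∂μ, ∀ᵐ y ∂ν, g (x, y) = c y :=
    (Measure.ae_ae_comm (p := fun y x => g (x, y) = c y)
      (measurableSet_eq_fun (hg.comp measurable_swap) (hc.comp measurable_fst))).1 h1
  obtain ⟨x, ⟨d, hd⟩, hx⟩ := (h'.and h2).exists
  refine ⟨d, ?_⟩
  filter_upwards [hd, hx, h1] with y hy hy' hy1
  rwa [← hy, hy']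

theorem ae_of_ae_unitSquare {P : unitInterval × unitInterval → Prop}
    (hP : MeasurableSet {p | P p}) :
    (∀ᵐ p, P p) ↔ ∀ᵐ y : unitInterval, ∀ᵐ x : unitInterval, P (x, y) := by
  rw [Measure.volume_eq_prod, Measure.ae_prod_iff_ae_ae hP]
  exact Measure.ae_ae_comm hP

namespace OrigamiDatum

variable (D : OrigamiDatum)

/-- A function invariant under a horizontal shear is constant on almost every horizontal line
through two neighbouring squares, since the shear rotates almost every closed horizontal line by
an irrational angle. -/
theorem ae_eq_const_of_horizontal {f : D.Surface → ℝ} (hf : Measurable f) {k : ℕ} (hk : 1 ≤ k)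
    (hc : D.σ ^ (k : ℤ) = 1)
    (hinv : ∀ i, ∀ᵐ p : unitInterval × unitInterval,
      f (D.horArr i (p.1 + k * p.2) p.2) = f (D.pt i p)) (i : Fin D.m) :
    ∀ᵐ y : unitInterval, ∃ C, (∀ᵐ x : unitInterval, f (D.pt i (x, y)) = C) ∧
      ∀ᵐ x : unitInterval, f (D.pt (D.σ⁻¹ i) (x, y)) = C := by
  have hinv' : ∀ᵐ y : unitInterval, ∀ i, ∀ᵐ x : unitInterval,
      f (D.horArr i (x + k * y) y) = f (D.pt i (x, y)) := by
    rw [ae_all_iff]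
    intro i
    refine (ae_of_ae_unitSquare (P := fun p => f (D.horArr i (p.1 + k * p.2) p.2) = f (D.pt i p))
      (measurableSet_eq_fun (hf.comp ?_) (hf.comp (D.continuous_pt i).measurable))).1 (hinv i)
    exact ((D.continuous_horArr i).comp (by fun_prop : Continuous
      fun p : unitInterval × unitInterval => ((p.1 + k * p.2 : ℝ), p.2))).measurable
  have hk0 : (k : ℝ) ≠ 0 := by positivity
  filter_upwards [hinv', ae_irrational] with y hy hirr
  have hg : Measurable fun t : ℝ => f (D.horArr i t y) :=
    hf.comp ((D.continuous_horArr i).comp (Continuous.prodMk_left y)).measurable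
  have hper : Function.Periodic (fun t : ℝ => f (D.horArr i t y)) k := by
    intro t
    have h := D.horArr_zpow i k t y
    rw [zpow_neg, hc, inv_one, Equiv.Perm.one_apply] at h
    change f _ = f _
    rw [h]; norm_cast
  obtain ⟨C, hC⟩ := exists_ae_eq_const_of_periodic hg (by positivity : (0 : ℝ) < k) hper
    (a := k * y) (by rwa [mul_div_cancel_left₀ _ hk0]) (ae_of_forall_int_add fun j => by
      filter_upwards [hy ((D.σ ^ (-j)) i)] with x hx
      rw [horArr_zpow, ← horArr_coe, horArr_zpow] at hx
      rw [← hx]; congr 2; ring)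
  have hk1 : (1 : ℝ) ≤ k := by exact_mod_cast hk
  refine ⟨C, ?_, ?_⟩
  · filter_upwards [ae_unitInterval_add_of_Ioc hk1 (hC 0)] with x hx
    rwa [add_zero, horArr_coe] at hx
  · filter_upwards [ae_unitInterval_add_of_Ioc hk1 (hC 1)] with x hx
    have h := D.horArr_zpow i 1 x y
    rw [zpow_neg, zpow_one, Int.cast_one, horArr_coe] at h
    rwa [h]

theorem ae_eq_const_of_vertical {f : D.Surface → ℝ} (hf : Measurable f) {k : ℕ} (hk : 1 ≤ k)
    (hc : D.τ ^ (k : ℤ) = 1)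
    (hinv : ∀ i, ∀ᵐ p : unitInterval × unitInterval,
      f (D.verArr i p.1 (k * p.1 + p.2)) = f (D.pt i p)) (i : Fin D.m) :
    ∀ᵐ x : unitInterval, ∃ C, (∀ᵐ y : unitInterval, f (D.pt i (x, y)) = C) ∧
      ∀ᵐ y : unitInterval, f (D.pt (D.τ i) (x, y)) = C := by
  have h := D.swap.ae_eq_const_of_horizontal (f := f ∘ D.swapHomeo.symm)
    (hf.comp D.swapHomeo.symm.continuous.measurable) hk (D.swap_zpow hc) (fun i => by
      filter_upwards [(Measure.measurePreserving_swap (μ := (volume : Measure unitInterval))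
        (ν := (volume : Measure unitInterval))).quasiMeasurePreserving.ae (hinv i)] with p hp
      have e : D.swapHomeo.symm (D.swap.horArr i (p.1 + k * p.2) p.2) =
          D.verArr i p.2 (k * p.2 + p.1) := by
        rw [add_comm]; exact D.swapHomeo_symm_horArr i _ _
      exact (congrArg f e).trans hp) i
  exact h

theorem ae_area_iff {P : D.Surface → Prop} (hP : MeasurableSet {x | P x}) :
    (∀ᵐ x ∂D.area, P x) ↔ ∀ i, ∀ᵐ p, P (D.pt i p) := by
  unfold area
  rw [Measure.ae_sum_iff' hP]
  exact forall_congr' fun i => ae_map_iff (D.continuous_pt i).measurable.aemeasurable hP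

/-- The group generated by a horizontal and a vertical shear acts ergodically. -/
theorem ae_eq_const_of_invariant {f : D.Surface → ℝ} (hf : Measurable f) {k : ℕ} (hk : 1 ≤ k)
    (hσ : D.σ ^ (k : ℤ) = 1) (hτ : D.τ ^ (k : ℤ) = 1)
    (hA : ∀ᵐ x ∂D.area, f (D.horShearHomeo k hσ x) = f x)
    (hB : ∀ᵐ x ∂D.area, f (D.verShearHomeo k hτ x) = f x) : ∃ C, ∀ᵐ x ∂D.area, f x = C := by
  have hA := (D.ae_area_iff (measurableSet_eq_fun
    (hf.comp (D.horShearHomeo k hσ).continuous.measurable) hf)).1 hA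
  have hB := (D.ae_area_iff (measurableSet_eq_fun
    (hf.comp (D.verShearHomeo k hτ).continuous.measurable) hf)).1 hB
  have hhor := D.ae_eq_const_of_horizontal hf hk hσ (fun i => by
    simpa only [Function.comp, horShearHomeo_pt, Int.cast_natCast] using hA i)
  have hver := D.ae_eq_const_of_vertical hf hk hτ (fun i => by
    simpa only [Function.comp, verShearHomeo_pt, Int.cast_natCast] using hB i)
  have hm : ∀ i, Measurable fun p => f (D.pt i p) := fun i =>
    hf.comp (D.continuous_pt i).measurable
  -- `f` is constant on each square, with the same constant on neighbouring squares.
  have hsq : ∀ i, ∃ d, ∀ᵐ y : unitInterval, ∀ᵐ x : unitInterval, f (D.pt i (x, y)) = d := fun i =>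
    ae_prod_const (hm i) ((hhor i).mono fun y ⟨C, hC⟩ => ⟨C, hC.1⟩)
      ((hver i).mono fun x ⟨C, hC⟩ => ⟨C, hC.1⟩)
  choose d hd using hsq
  have hd' : ∀ i, ∀ᵐ x : unitInterval, ∀ᵐ y : unitInterval, f (D.pt i (x, y)) = d i := fun i =>
    (Measure.ae_ae_comm (p := fun y x => f (D.pt i (x, y)) = d i)
      (measurableSet_eq_fun ((hm i).comp measurable_swap)
      measurable_const)).1 (hd i)
  have hσd : ∀ i, d (D.σ⁻¹ i) = d i := fun i => by
    obtain ⟨y, ⟨⟨C, h1, h2⟩, h3⟩, h4⟩ := (((hhor i).and (hd i)).and (hd (D.σ⁻¹ i))).exists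
    obtain ⟨x, ⟨⟨h1, h2⟩, h3⟩, h4⟩ := (((h1.and h2).and h3).and h4).exists
    rw [← h3, ← h4, h1, h2]
  have hτd : ∀ i, d (D.τ i) = d i := fun i => by
    obtain ⟨y, ⟨⟨C, h1, h2⟩, h3⟩, h4⟩ := (((hver i).and (hd' i)).and (hd' (D.τ i))).exists
    obtain ⟨x, ⟨⟨h1, h2⟩, h3⟩, h4⟩ := (((h1.and h2).and h3).and h4).exists
    rw [← h3, ← h4, h1, h2]
  have hgd : ∀ g ∈ Subgroup.closure {D.σ, D.τ}, ∀ i, d (g i) = d i := by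
    intro g hg
    induction hg using Subgroup.closure_induction with
    | mem g hg =>
      rcases hg with rfl | rfl
      · intro i
        have := hσd (D.σ i)
        rw [show D.σ⁻¹ (D.σ i) = i from D.σ.symm_apply_apply i] at this
        exact this.symm
      · exact hτd
    | one => exact fun i => rfl
    | mul g h _ _ hg hh => exact fun i => (hg _).trans (hh i)
    | inv g _ hg =>
      intro i
      have := hg (g⁻¹ i)
      rw [show g (g⁻¹ i) = i from g.apply_symm_apply i] at this
      exact this.symm
  refine ⟨d ⟨0, D.m_pos⟩, (D.ae_area_iff (measurableSet_eq_fun hf measurable_const)).2 fun i =>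
    (ae_of_ae_unitSquare (measurableSet_eq_fun (hm i) measurable_const)).2 ?_⟩
  obtain ⟨g, hg, rfl⟩ := D.transitive ⟨0, D.m_pos⟩ i
  rw [← hgd g hg]
  exact hd _

end OrigamiDatum

/-! ### Spectral gap and expansion in measure -/

/-- An ergodic finite cover of a system with spectral gap has spectral gap: ergodicity identifies
the kernel of the displacement operator with the constant functions. -/
theorem IsFiniteCover.exists_gap_of_ergodic {ι Z X : Type*} [Fintype ι] [MeasurableSpace Z]
    [MeasurableSpace X] {P : ι → Z → X} {ν : Measure Z} {μ : Measure X} [IsProbabilityMeasure ν]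
    (hP : IsFiniteCover P ν μ) {A B : X → X} {α β : Z → Z} (hA : MeasurePreserving A μ μ)
    (hB : MeasurePreserving B μ μ) (hα : MeasurePreserving α ν ν) (hβ : MeasurePreserving β ν ν)
    (hAα : LiftsAlong P A α) (hBβ : LiftsAlong P B β) {C : ℝ} (hC : 0 ≤ C)
    (hgap : HasQuadraticGap ν α β C)
    (herg : ∀ f : X → ℝ, Measurable f → (∀ᵐ x ∂μ, f (A x) = f x) → (∀ᵐ x ∂μ, f (B x) = f x) →
      ∃ c, ∀ᵐ x ∂μ, f x = c) :
    ∃ K : ℝ, 0 ≤ K ∧ ∀ f : X → ℝ, MemLp f 2 μ → ∫ x, f x ∂μ = 0 →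
      ∫ x, f x ^ 2 ∂μ ≤
        K * ((∫ x, (f (A x) - f x) ^ 2 ∂μ) + ∫ x, (f (B x) - f x) ^ 2 ∂μ) := by
  let W : (F : X → X) → MeasurePreserving F μ μ → Lp ℝ 2 μ →L[ℝ] Lp ℝ 2 μ := fun F hF =>
    (Lp.compMeasurePreservingₗᵢ ℝ F hF).toContinuousLinearMap - ContinuousLinearMap.id ℝ _
  have hW : ∀ F (hF : MeasurePreserving F μ μ) f, W F hF f =ᵐ[μ] fun x => f (F x) - f x := by
    intro F hF f
    have h1 : W F hF f = Lp.compMeasurePreserving F hF f - f := rfl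
    rw [h1]
    filter_upwards [Lp.coeFn_sub (Lp.compMeasurePreserving F hF f) f,
      Lp.coeFn_compMeasurePreserving f hF] with x hx hx'
    rw [hx, Pi.sub_apply, hx', Function.comp]
  have hWn : ∀ F (hF : MeasurePreserving F μ μ) f,
      ‖W F hF f‖ ^ 2 = ∫ x, (f (F x) - f x) ^ 2 ∂μ := by
    intro F hF f
    rw [norm_sq_eq_integral_sq]
    exact integral_congr_ae ((hW F hF f).fun_comp (· ^ 2))
  let T : Lp ℝ 2 μ →L[ℝ] WithLp 2 (Lp ℝ 2 μ × Lp ℝ 2 μ) :=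
    (WithLp.prodContinuousLinearEquiv 2 ℝ _ _).symm.toContinuousLinearMap.comp
      ((W A hA).prod (W B hB))
  have hTn : ∀ f, ‖T f‖ ^ 2 = ‖W A hA f‖ ^ 2 + ‖W B hB f‖ ^ 2 := fun f =>
    WithLp.prod_norm_sq_eq_of_L2 _
  have hT : ∀ f, ‖T f‖ ^ 2 =
      (∫ x, (f (A x) - f x) ^ 2 ∂μ) + ∫ x, (f (B x) - f x) ^ 2 ∂μ := fun f => by
    rw [hTn, hWn, hWn]
  obtain ⟨κ, hκ, hgapT⟩ := hP.exists_gap hA hB hα hβ hAα hBβ hC hgap T hT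
  refine ⟨(κ ^ 2)⁻¹, by positivity, fun f hf hf0 => ?_⟩
  have hmem : hf.toLp f ∈ T.kerᗮ := by
    rw [Submodule.mem_orthogonal]
    intro g hg
    have hg0 : ‖W A hA g‖ ^ 2 + ‖W B hB g‖ ^ 2 = 0 := by
      rw [← hTn, show T g = 0 from hg]; simp
    have hz : ∀ F (hF : MeasurePreserving F μ μ), ‖W F hF g‖ ^ 2 = 0 → ∀ᵐ x ∂μ, g (F x) = g x := by
      intro F hF h0
      have h1 : W F hF g = 0 := by simpa using h0
      have h2 := hW F hF g
      rw [h1] at h2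
      filter_upwards [h2, Lp.coeFn_zero ℝ 2 μ] with x hx hx'
      rw [hx'] at hx
      exact (sub_eq_zero.1 hx.symm)
    obtain ⟨c, hc⟩ := herg g (Lp.stronglyMeasurable g).measurable
      (hz A hA (by linarith [sq_nonneg ‖W A hA g‖, sq_nonneg ‖W B hB g‖]))
      (hz B hB (by linarith [sq_nonneg ‖W A hA g‖, sq_nonneg ‖W B hB g‖]))
    rw [L2.inner_def]
    have : ∫ x, inner ℝ (g x) (hf.toLp f x) ∂μ = ∫ x, f x * c ∂μ := by
      refine integral_congr_ae ?_
      filter_upwards [hc, hf.coeFn_toLp] with x hx hx'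
      rw [hx, hx']; simp [mul_comm]
    rw [this, integral_mul_const, hf0, zero_mul]
  have h := hgapT _ hmem
  have h2 : κ ^ 2 * ‖hf.toLp f‖ ^ 2 ≤ ‖T (hf.toLp f)‖ ^ 2 := by
    rw [← mul_pow]; gcongr
  have e1 : ‖hf.toLp f‖ ^ 2 = ∫ x, f x ^ 2 ∂μ := by
    rw [norm_sq_eq_integral_sq]
    exact integral_congr_ae (hf.coeFn_toLp.fun_comp (· ^ 2))
  have e2 : ∀ F, MeasurePreserving F μ μ → ∫ x, (hf.toLp f (F x) - hf.toLp f x) ^ 2 ∂μ =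
      ∫ x, (f (F x) - f x) ^ 2 ∂μ := by
    intro F hF
    refine integral_congr_ae ?_
    filter_upwards [hf.coeFn_toLp, hF.quasiMeasurePreserving.ae hf.coeFn_toLp] with x hx hx'
    rw [hx, hx']
  rw [hT, e1, e2 A hA, e2 B hB] at h2
  rw [inv_mul_eq_div, le_div_iff₀ (by positivity), mul_comm]
  exact h2

theorem eLpNorm_two_sq_eq_ofReal {X : Type*} [MeasurableSpace X] {μ : Measure X} {f : X → ℂ}
    (hf : MemLp f 2 μ) : eLpNorm f 2 μ ^ 2 = ENNReal.ofReal (∫ x, ‖f x‖ ^ 2 ∂μ) := by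
  have h := eLpNorm_nnreal_pow_eq_lintegral (f := f) (μ := μ) (p := 2) two_ne_zero
  rw [ofReal_integral_eq_lintegral_ofReal hf.norm.integrable_sq
    (Filter.Eventually.of_forall fun x => sq_nonneg _)]
  simp only [ENNReal.coe_ofNat, NNReal.coe_ofNat, ENNReal.rpow_ofNat] at h
  rw [h]
  refine lintegral_congr fun x => ?_
  rw [ENNReal.ofReal_pow (norm_nonneg _), ofReal_norm]

/-- A quadratic gap inequality for real functions yields a gap inequality for the norms of complex
functions, by considering real and imaginary parts. -/
theorem exists_eLpNorm_le_of_quadratic {X : Type*} [MeasurableSpace X] {μ : Measure X}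
    [IsFiniteMeasure μ] {A B : X → X} (hA : MeasurePreserving A μ μ) (hB : MeasurePreserving B μ μ)
    {K : ℝ} (hK : 0 ≤ K)
    (hgap : ∀ f : X → ℝ, MemLp f 2 μ → ∫ x, f x ∂μ = 0 → ∫ x, f x ^ 2 ∂μ ≤
        K * ((∫ x, (f (A x) - f x) ^ 2 ∂μ) + ∫ x, (f (B x) - f x) ^ 2 ∂μ))
    {f : X → ℂ} (hf : MemLp f 2 μ) (hf0 : ∫ x, f x ∂μ = 0) :
    eLpNorm f 2 μ ≤ ENNReal.ofReal √K *
      (eLpNorm (fun x => f (A x) - f x) 2 μ + eLpNorm (fun x => f (B x) - f x) 2 μ) := by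
  have hsq : ∀ {h : X → ℂ}, MemLp h 2 μ →
      ∫ x, ‖h x‖ ^ 2 ∂μ = (∫ x, (h x).re ^ 2 ∂μ) + ∫ x, (h x).im ^ 2 ∂μ := by
    intro h hh
    have h1 : Integrable (fun x => (h x).re ^ 2) μ := hh.re.integrable_sq
    have h2 : Integrable (fun x => (h x).im ^ 2) μ := hh.im.integrable_sq
    rw [← integral_add h1 h2]
    refine integral_congr_ae (Filter.Eventually.of_forall fun x => ?_)
    change ‖h x‖ ^ 2 = (h x).re ^ 2 + (h x).im ^ 2
    rw [← Complex.normSq_eq_norm_sq, Complex.normSq_apply]; ring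
  have hfi : Integrable f μ := hf.integrable one_le_two
  have hdA : MemLp (fun x => f (A x) - f x) 2 μ := (hf.comp_measurePreserving hA).sub hf
  have hdB : MemLp (fun x => f (B x) - f x) 2 μ := (hf.comp_measurePreserving hB).sub hf
  have hre := hgap (fun x => (f x).re) hf.re (by
    have := integral_re hfi
    simp only [RCLike.re_to_complex] at this
    rw [this, hf0]; simp)
  have him := hgap (fun x => (f x).im) hf.im (by
    have := integral_im hfi
    simp only [RCLike.im_to_complex] at this
    rw [this, hf0]; simp)
  have hmain : ∫ x, ‖f x‖ ^ 2 ∂μ ≤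
      K * ((∫ x, ‖f (A x) - f x‖ ^ 2 ∂μ) + ∫ x, ‖f (B x) - f x‖ ^ 2 ∂μ) := by
    rw [hsq hf, hsq hdA, hsq hdB]
    simp only [Complex.sub_re, Complex.sub_im]
    linarith
  rw [← ENNReal.pow_le_pow_left_iff two_ne_zero, mul_pow, eLpNorm_two_sq_eq_ofReal hf,
    ← ENNReal.ofReal_pow (Real.sqrt_nonneg K), Real.sq_sqrt hK]
  calc ENNReal.ofReal (∫ x, ‖f x‖ ^ 2 ∂μ)
      ≤ ENNReal.ofReal K * (eLpNorm (fun x => f (A x) - f x) 2 μ ^ 2 +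
          eLpNorm (fun x => f (B x) - f x) 2 μ ^ 2) := by
        rw [eLpNorm_two_sq_eq_ofReal hdA, eLpNorm_two_sq_eq_ofReal hdB,
          ← ENNReal.ofReal_add (by positivity) (by positivity), ← ENNReal.ofReal_mul hK]
        exact ENNReal.ofReal_le_ofReal hmain
    _ ≤ _ := by
        gcongr
        rw [add_sq]
        exact add_le_add_left (le_self_add) _

section Group

variable {G X : Type*} [Group G] [TopologicalSpace X] [MeasurableSpace X]
  {φ : G →* (X ≃ₜ X)} {μ : Measure X} {S : Finset G}

/-- Up to a constant, the displacement of a function by any element of the group is bounded by its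
displacement by a generating set. -/
theorem exists_displacement_le (hφ : ∀ g, MeasurePreserving (φ g) μ μ)
    (hS : Subgroup.closure (S : Set G) = ⊤) (g : G) :
    ∃ C : ℝ≥0, ∀ f : X → ℂ, MemLp f 2 μ → eLpNorm (fun x => f (φ g⁻¹ x) - f x) 2 μ ≤
      C * ∑ s ∈ S, eLpNorm (fun x => f (φ s⁻¹ x) - f x) 2 μ := by
  have hd : ∀ g {f : X → ℂ}, MemLp f 2 μ → AEStronglyMeasurable (fun x => f (φ g x) - f x) μ :=
    fun g f hf => ((hf.comp_measurePreserving (hφ g)).sub hf).aestronglyMeasurable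
  have hg : g ∈ Subgroup.closure (S : Set G) := hS ▸ Subgroup.mem_top g
  induction hg using Subgroup.closure_induction with
  | mem g hg =>
    refine ⟨1, fun f _ => ?_⟩
    rw [ENNReal.coe_one, one_mul]
    exact Finset.single_le_sum (f := fun s => eLpNorm (fun x => f (φ s⁻¹ x) - f x) 2 μ)
      (fun _ _ => zero_le) hg
  | one => exact ⟨0, fun f _ => by simp⟩
  | mul g h _ _ ihg ihh =>
    obtain ⟨C, hC⟩ := ihg
    obtain ⟨C', hC'⟩ := ihh
    refine ⟨C' + C, fun f hf => ?_⟩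
    have e : (fun x => f (φ (g * h)⁻¹ x) - f x) =
        (fun x => f (φ h⁻¹ x) - f x) ∘ φ g⁻¹ + fun x => f (φ g⁻¹ x) - f x := by
      funext x
      simp [mul_inv_rev, map_mul]
    rw [e, ENNReal.coe_add, add_mul]
    refine (eLpNorm_add_le ((hd _ hf).comp_measurePreserving (hφ _)) (hd _ hf) one_le_two).trans
      (add_le_add ?_ (hC f hf))
    rw [eLpNorm_comp_measurePreserving (hd _ hf) (hφ _)]
    exact hC' f hf
  | inv g _ ih =>
    obtain ⟨C, hC⟩ := ih
    refine ⟨C, fun f hf => ?_⟩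
    have e : (fun x => f (φ g⁻¹⁻¹ x) - f x) = -((fun x => f (φ g⁻¹ x) - f x) ∘ φ g) := by
      funext x
      simp
    rw [e, eLpNorm_neg, eLpNorm_comp_measurePreserving (hd _ hf) (hφ _)]
    exact hC f hf

theorem hasSpectralGap_of_exists_pair (hφ : ∀ g, MeasurePreserving (φ g) μ μ)
    (hS : Subgroup.closure (S : Set G) = ⊤) {a b : G} {K : ℝ}
    (hgap : ∀ f : X → ℂ, MemLp f 2 μ → ∫ x, f x ∂μ = 0 → eLpNorm f 2 μ ≤ ENNReal.ofReal K *
      (eLpNorm (fun x => f (φ a x) - f x) 2 μ + eLpNorm (fun x => f (φ b x) - f x) 2 μ)) :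
    HasSpectralGap S φ μ := by
  obtain ⟨C, hC⟩ := exists_displacement_le hφ hS a⁻¹
  obtain ⟨C', hC'⟩ := exists_displacement_le hφ hS b⁻¹
  simp only [inv_inv] at hC hC'
  let M : ℝ≥0 := K.toNNReal * (C + C') + 1
  have hM : (M : ℝ≥0∞) ≠ 0 := by simp [M]
  refine ⟨(M⁻¹ : ℝ≥0), by positivity, fun f hf hf0 => ?_⟩
  rw [ENNReal.ofReal_coe_nnreal, ENNReal.coe_inv (by exact_mod_cast hM), mul_comm,
    ← div_eq_mul_inv]
  refine ENNReal.div_le_of_le_mul' ((hgap f hf hf0).trans ?_)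
  refine (mul_le_mul_right (add_le_add (hC f hf) (hC' f hf)) _).trans ?_
  rw [← add_mul, ← mul_assoc]
  refine mul_le_mul_left ?_ _
  change (K.toNNReal : ℝ≥0∞) * (C + C') ≤ M
  exact_mod_cast le_self_add

theorem HasSpectralGap.smul_measure (h : HasSpectralGap S φ μ) {c : ℝ≥0∞} (hc : c ≠ 0)
    (hc' : c ≠ ∞) : HasSpectralGap S φ (c • μ) := by
  obtain ⟨κ, hκ, h⟩ := h
  refine ⟨κ, hκ, fun f hf hf0 => ?_⟩
  have h1 : MemLp f 2 μ := by
    have := hf.smul_measure (ENNReal.inv_ne_top.2 hc)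
    rwa [smul_smul, ENNReal.inv_mul_cancel hc hc', one_smul] at this
  have h0 : ∫ x, f x ∂μ = 0 := by
    rw [integral_smul_measure, smul_eq_zero] at hf0
    exact hf0.resolve_left (ENNReal.toReal_ne_zero.2 ⟨hc, hc'⟩)
  simp only [eLpNorm_smul_measure_of_ne_zero hc, smul_eq_mul]
  rw [← Finset.mul_sum, mul_left_comm]
  exact mul_le_mul_right (h f h1 h0) _

end Group

section Expansion

variable {G X : Type*} [Group G] [TopologicalSpace X] [MeasurableSpace X] [BorelSpace X]
  {φ : G →* (X ≃ₜ X)} {μ : Measure X} {S : Finset G}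

/-- Spectral gap implies expansion in measure: apply the gap inequality to the indicator function
of `U` minus its mean. As `1 ∈ S`, each displacement is at most `√(2 μ (SU \ U))`. -/
theorem HasSpectralGap.measureExpanding [IsFiniteMeasure μ]
    (hφ : ∀ g, MeasurePreserving (φ g) μ μ) (hS : 1 ∈ S) (h : HasSpectralGap S φ μ) :
    MeasureExpanding S φ μ := by
  obtain ⟨κ, hκ, h⟩ := h
  have hn : (0 : ℝ) < S.card := by exact_mod_cast Finset.card_pos.2 ⟨1, hS⟩
  refine ⟨κ ^ 2 / (8 * S.card ^ 2), by positivity, fun U hU _ hU0 hU2 => ?_⟩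
  have hXU : 0 < μ Set.univ := hU0.trans_le (measure_mono (Set.subset_univ U))
  have hX : 0 < μ.real Set.univ := ENNReal.toReal_pos hXU.ne' (measure_ne_top _ _)
  have hU2' : μ.real U ≤ 2⁻¹ * μ.real Set.univ := by
    have := ENNReal.toReal_mono (ENNReal.mul_ne_top (by simp) (measure_ne_top _ _)) hU2
    simpa [Measure.real] using this
  set W : Set X := ⋃ s ∈ S, φ s '' U
  have himg : ∀ s, MeasurableSet (φ s '' U) := fun s =>
    (φ s).toMeasurableEquiv.measurableSet_image.2 hU
  have hUW : U ⊆ W := fun x hx => Set.mem_iUnion₂.2 ⟨1, hS, x, hx, by simp⟩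
  have hmeas : ∀ s, μ (φ s '' U) = μ U := fun s => by
    rw [← (hφ s).measure_preimage (himg s).nullMeasurableSet,
      Set.preimage_image_eq _ (φ s).injective]
  let t : ℝ := μ.real U / μ.real Set.univ
  have ht : t ≤ 1 / 2 := by
    change _ / _ ≤ _
    rw [div_le_iff₀ hX]; linarith
  let f : X → ℂ := fun x => U.indicator (fun _ => (1 : ℂ)) x - (t : ℂ)
  have hi : MemLp (U.indicator fun _ => (1 : ℂ)) 2 μ :=
    memLp_indicator_const 2 hU 1 (Or.inr (measure_ne_top _ _))
  have hf : MemLp f 2 μ := hi.sub (memLp_const _)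
  have hf0 : ∫ x, f x ∂μ = 0 := by
    change ∫ x, (U.indicator (fun _ => (1 : ℂ)) x - (t : ℂ)) ∂μ = 0
    rw [integral_sub (hi.integrable one_le_two) (integrable_const _), integral_indicator_const _ hU,
      integral_const]
    simp only [Complex.real_smul, mul_one, t]
    rw [← Complex.ofReal_mul, mul_div_cancel₀ _ hX.ne', sub_self]
  have hlow : 2⁻¹ * μ U ^ (1 / 2 : ℝ) ≤ eLpNorm f 2 μ := by
    have h1 := eLpNorm_indicator_const (μ := μ) (c := (1 / 2 : ℝ)) hU two_ne_zero
      ENNReal.ofNat_ne_top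
    have h2 : ‖(1 / 2 : ℝ)‖ₑ = 2⁻¹ := by
      rw [Real.enorm_eq_ofReal (by norm_num), one_div, ENNReal.ofReal_inv_of_pos (by norm_num)]
      simp
    rw [h2, ENNReal.toReal_ofNat] at h1
    rw [← h1]
    refine eLpNorm_mono fun x => ?_
    by_cases hx : x ∈ U
    · have : f x = ((1 - t : ℝ) : ℂ) := by simp [f, hx]
      rw [this, Complex.norm_real, Set.indicator_of_mem hx, Real.norm_of_nonneg (by norm_num)]
      exact (by linarith : (1 / 2 : ℝ) ≤ 1 - t).trans (le_abs_self _)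
    · simp [hx]
  have hup : ∀ s ∈ S, eLpNorm (fun x => f (φ s⁻¹ x) - f x) 2 μ ≤
      (2 * μ (W \ U)) ^ (1 / 2 : ℝ) := by
    intro s hs
    have hsW : φ s '' U ⊆ W := fun x hx => Set.mem_iUnion₂.2 ⟨s, hs, hx⟩
    have hmem : ∀ x, φ s⁻¹ x ∈ U ↔ x ∈ φ s '' U := by
      intro x
      constructor
      · exact fun hx => ⟨_, hx, by simp⟩
      · rintro ⟨y, hy, rfl⟩; simpa using hy
    have h1 : eLpNorm (fun x => f (φ s⁻¹ x) - f x) 2 μ =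
        eLpNorm ((symmDiff (φ s '' U) U).indicator fun _ => (1 : ℝ)) 2 μ := by
      refine eLpNorm_congr_norm_ae (Filter.Eventually.of_forall fun x => ?_)
      have e : f (φ s⁻¹ x) - f x =
          U.indicator (fun _ => (1 : ℂ)) (φ s⁻¹ x) - U.indicator (fun _ => (1 : ℂ)) x :=
        sub_sub_sub_cancel_right _ _ _
      have hs' := hmem x
      rw [e]
      by_cases hx : x ∈ U <;> by_cases hx' : φ s⁻¹ x ∈ U <;>
        simp only [Set.indicator, ← hs', hx, hx', Set.mem_symmDiff] <;> simp
    rw [h1, eLpNorm_indicator_const ((himg s).symmDiff hU) two_ne_zero ENNReal.ofNat_ne_top,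
      enorm_one, one_mul, ENNReal.toReal_ofNat]
    refine ENNReal.rpow_le_rpow ?_ (by norm_num)
    have h3 : μ (U \ φ s '' U) = μ (φ s '' U \ U) := by
      have e1 := measure_sdiff_add_inter (μ := μ) U (himg s)
      have e2 := measure_sdiff_add_inter (μ := μ) (φ s '' U) hU
      rw [hmeas, ← e1, Set.inter_comm] at e2
      exact ((ENNReal.add_left_inj (measure_ne_top _ _)).1 e2).symm
    rw [Set.symmDiff_def, two_mul]
    refine (measure_union_le _ _).trans ?_
    rw [h3]
    have : μ (φ s '' U \ U) ≤ μ (W \ U) := measure_mono (Set.sdiff_subset_sdiff_left hsW)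
    exact add_le_add this this
  have hkey : ENNReal.ofReal κ * (2⁻¹ * μ U ^ (1 / 2 : ℝ)) ≤
      S.card * (2 * μ (W \ U)) ^ (1 / 2 : ℝ) := by
    refine (mul_le_mul_right hlow _).trans ((h f hf hf0).trans ?_)
    rw [← nsmul_eq_mul]
    exact Finset.sum_le_card_nsmul _ _ _ hup
  have hsq : ∀ z : ℝ≥0∞, (z ^ (1 / 2 : ℝ)) ^ 2 = z := fun z => by
    rw [← ENNReal.rpow_natCast, ← ENNReal.rpow_mul]; norm_num
  have hkey2 := pow_le_pow_left' hkey 2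
  rw [mul_pow, mul_pow, mul_pow, hsq, hsq] at hkey2
  have hkey3 : κ ^ 2 * ((2⁻¹) ^ 2 * μ.real U) ≤ S.card ^ 2 * (2 * μ.real (W \ U)) := by
    have := ENNReal.toReal_mono (by finiteness) hkey2
    simpa [Measure.real, ENNReal.toReal_ofReal hκ.le] using this
  have hfin : κ ^ 2 / (8 * S.card ^ 2) * μ.real U ≤ μ.real (W \ U) := by
    rw [div_mul_eq_mul_div, div_le_iff₀ (by positivity)]
    linarith
  have hsplit : μ W = μ U + μ (W \ U) := by
    rw [measure_add_sdiff hU.nullMeasurableSet, Set.union_eq_self_of_subset_left hUW]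
  rw [hsplit, add_mul, one_mul]
  gcongr
  rw [← ofReal_measureReal (measure_ne_top μ U), ← ofReal_measureReal (measure_ne_top μ (W \ U)),
    ← ENNReal.ofReal_mul (by positivity)]
  exact ENNReal.ofReal_le_ofReal hfin

end Expansion

theorem freeGroup_fin_two_induction {p : FreeGroup (Fin 2) → Prop} (one : p 1)
    (of_zero : p (FreeGroup.of 0)) (of_one : p (FreeGroup.of 1))
    (inv_of : ∀ i, p (FreeGroup.of i) → p (FreeGroup.of i)⁻¹)
    (mul : ∀ g h, p g → p h → p (g * h)) (g : FreeGroup (Fin 2)) : p g :=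
  FreeGroup.induction_on g one (fun i => by fin_cases i <;> assumption) inv_of mul

/-! ### The action on the origami surface -/

namespace OrigamiDatum

variable (D : OrigamiDatum)

theorem area_univ : D.area Set.univ = D.m := by
  unfold area
  rw [Measure.sum_apply _ MeasurableSet.univ, tsum_fintype]
  simp [Measure.map_apply (D.continuous_pt _).measurable MeasurableSet.univ]

instance : IsFiniteMeasure D.area := ⟨by rw [area_univ]; exact ENNReal.natCast_lt_top _⟩

theorem measurePreserving_horShearHomeo (k : ℕ) (hc : D.σ ^ (k : ℤ) = 1) :
    MeasurePreserving (D.horShearHomeo k hc) D.area D.area :=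
  D.isFiniteCover_fiberPt.measurePreserving (D.horShearHomeo k hc).continuous.measurable
    (measurePreserving_torusAct _) (D.liftsAlong_horShearHomeo k hc)

theorem measurePreserving_verShearHomeo (k : ℕ) (hc : D.τ ^ (k : ℤ) = 1) :
    MeasurePreserving (D.verShearHomeo k hc) D.area D.area :=
  D.isFiniteCover_fiberPt.measurePreserving (D.verShearHomeo k hc).continuous.measurable
    (measurePreserving_torusAct _) (D.liftsAlong_verShearHomeo k hc)

/-- The action of the free group on the surface in which the generators act by shears. -/
def shearAction (k : ℕ) (hσ : D.σ ^ (k : ℤ) = 1) (hτ : D.τ ^ (k : ℤ) = 1) :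
    FreeGroup (Fin 2) →* (D.Surface ≃ₜ D.Surface) :=
  FreeGroup.lift ![D.horShearHomeo k hσ, D.verShearHomeo k hτ]

section Action

variable {k : ℕ} (hσ : D.σ ^ (k : ℤ) = 1) (hτ : D.τ ^ (k : ℤ) = 1)

theorem shearAction_of_zero : D.shearAction k hσ hτ (FreeGroup.of 0) = D.horShearHomeo k hσ := by
  simp [shearAction]

theorem shearAction_of_one : D.shearAction k hσ hτ (FreeGroup.of 1) = D.verShearHomeo k hτ := by
  simp [shearAction]

theorem isOrigamiAction_shearAction : D.IsOrigamiAction k (D.shearAction k hσ hτ) := by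
  intro i x y
  rw [shearAction_of_zero, shearAction_of_one, horShearHomeo_pt, verShearHomeo_pt]
  exact ⟨rfl, rfl⟩

theorem measurePreserving_shearAction (g : FreeGroup (Fin 2)) :
    MeasurePreserving (D.shearAction k hσ hτ g) D.area D.area := by
  refine freeGroup_fin_two_induction (p := fun g => MeasurePreserving (D.shearAction k hσ hτ g)
    D.area D.area) ?_ ?_ ?_ (fun i h => ?_) (fun g h hg hh => ?_) g
  · rw [map_one]; exact MeasurePreserving.id _
  · rw [shearAction_of_zero]; exact D.measurePreserving_horShearHomeo k hσ
  · rw [shearAction_of_one]; exact D.measurePreserving_verShearHomeo k hτ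
  · rw [map_inv]
    exact MeasurePreserving.symm (D.shearAction k hσ hτ (FreeGroup.of i)).toMeasurableEquiv h
  · rw [map_mul]; exact hg.comp hh

theorem toTorus_horShearHomeo (x : D.Surface) :
    D.toTorus (D.horShearHomeo k hσ x) = torusAct (matA k) (D.toTorus x) := by
  obtain ⟨⟨i, p⟩, rfl⟩ := Quot.exists_rep x
  change D.toTorus (D.horShearHomeo k hσ (D.pt i p)) = torusAct (matA k) (D.toTorus (D.pt i p))
  rw [horShearHomeo_pt, toTorus_horArr, toTorus_pt, torusAct_torusProj]
  simp [planeAct, matA]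

theorem toTorus_verShearHomeo (x : D.Surface) :
    D.toTorus (D.verShearHomeo k hτ x) = torusAct (matB k) (D.toTorus x) := by
  obtain ⟨⟨i, p⟩, rfl⟩ := Quot.exists_rep x
  change D.toTorus (D.verShearHomeo k hτ (D.pt i p)) = torusAct (matB k) (D.toTorus (D.pt i p))
  rw [verShearHomeo_pt, toTorus_verArr, toTorus_pt, torusAct_torusProj]
  simp [planeAct, matB]

theorem toTorus_shearAction (g : FreeGroup (Fin 2)) (x : D.Surface) :
    D.toTorus (D.shearAction k hσ hτ g x) = torusAct (freeToSL k g) (D.toTorus x) := by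
  refine freeGroup_fin_two_induction (p := fun g => ∀ x, D.toTorus (D.shearAction k hσ hτ g x) =
    torusAct (freeToSL k g) (D.toTorus x)) ?_ ?_ ?_ (fun i h x => ?_) (fun g h hg hh x => ?_) g x
  · intro x; rw [map_one, map_one, torusAct_one]; rfl
  · intro x; rw [shearAction_of_zero, toTorus_horShearHomeo]; simp [freeToSL]
  · intro x; rw [shearAction_of_one, toTorus_verShearHomeo]; simp [freeToSL]
  · have h1 := h (D.shearAction k hσ hτ (FreeGroup.of i)⁻¹ x)
    rw [← Homeomorph.mul_apply, ← map_mul, mul_inv_cancel, map_one] at h1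
    rw [← torusAct_one (D.toTorus _), ← map_one (freeToSL k), ← inv_mul_cancel (FreeGroup.of i),
      map_mul, torusAct_mul, ← h1]
    rfl
  · rw [map_mul, map_mul, torusAct_mul, ← hh, ← hg]; rfl

theorem isFlatLipschitz_shearAction (g : FreeGroup (Fin 2)) :
    D.IsFlatLipschitz (D.shearAction k hσ hτ g) := by
  refine freeGroup_fin_two_induction (p := fun g => D.IsFlatLipschitz (D.shearAction k hσ hτ g))
    ?_ ?_ ?_ (fun i _ => ?_) (fun g h hg hh => ?_) g
  · rw [map_one]; exact ⟨1, fun x y => by simp⟩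
  · rw [shearAction_of_zero]; exact D.isFlatLipschitz_horShearHomeo _ _
  · rw [shearAction_of_one]; exact D.isFlatLipschitz_verShearHomeo _ _
  · rw [map_inv]
    -- The inverse of a shear is the shear with the opposite parameter.
    fin_cases i
    · change D.IsFlatLipschitz (D.shearAction k hσ hτ (FreeGroup.of 0)).symm
      rw [shearAction_of_zero]
      exact D.isFlatLipschitz_horShearHomeo (-k) (by rw [zpow_neg, hσ, inv_one])
    · change D.IsFlatLipschitz (D.shearAction k hσ hτ (FreeGroup.of 1)).symm
      rw [shearAction_of_one]
      exact D.isFlatLipschitz_verShearHomeo (-k) (by rw [zpow_neg, hτ, inv_one])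
  · rw [map_mul]; exact hg.comp hh

/-- The action on the surface inherits spectral gap from the torus. -/
theorem hasSpectralGap_shearAction (hk : 2 ≤ k) {S : Finset (FreeGroup (Fin 2))}
    (hS : Subgroup.closure (S : Set (FreeGroup (Fin 2))) = ⊤) :
    HasSpectralGap S (D.shearAction k hσ hτ) D.area := by
  have hA := D.measurePreserving_horShearHomeo k hσ
  have hB := D.measurePreserving_verShearHomeo k hτ
  obtain ⟨K, hK, hgap⟩ := D.isFiniteCover_fiberPt.exists_gap_of_ergodic hA hB
    (measurePreserving_torusAct (matA k)) (measurePreserving_torusAct (matB k))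
    (D.liftsAlong_horShearHomeo k hσ) (D.liftsAlong_verShearHomeo k hτ) (C := 102) (by norm_num)
    (fun h hh => torus_spectral_gap hk hh)
    (fun f hf => D.ae_eq_const_of_invariant hf (one_le_two.trans hk) hσ hτ)
  refine hasSpectralGap_of_exists_pair (D.measurePreserving_shearAction hσ hτ) hS
    (a := FreeGroup.of 0) (b := FreeGroup.of 1) (K := √K) fun f hf hf0 => ?_
  rw [shearAction_of_zero, shearAction_of_one]
  exact exists_eLpNorm_le_of_quadratic hA hB hK hgap hf hf0

end Action

end OrigamiDatum

end

theorem theoremA (D : OrigamiDatum) (k : ℕ) (hk : 2 ≤ k)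
    (hσ : orderOf D.σ ∣ k) (hτ : orderOf D.τ ∣ k) :
    Function.Injective (freeToSL k) ∧
    ∃ φ : FreeGroup (Fin 2) →* (D.Surface ≃ₜ D.Surface),
      D.IsOrigamiAction k φ ∧
      (∀ g, MeasurePreserving (φ g) D.area D.area) ∧
      (∀ g x, D.toTorus (φ g x) = torusAct (freeToSL k g) (D.toTorus x)) ∧
      (∀ g, D.IsAffineWith (φ g) (freeToSL k g)) ∧
      (∀ g, ∃ K : ℝ≥0, ∀ x y, D.flatDist (φ g x) (φ g y) ≤ K * D.flatDist x y) ∧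
      ∀ S : Finset (FreeGroup (Fin 2)), IsSymmGenSet S →
        MeasureExpanding S φ D.area ∧ HasSpectralGap S φ D.normArea := by
  have hσ' : D.σ ^ (k : ℤ) = 1 := by rw [zpow_natCast]; exact orderOf_dvd_iff_pow_eq_one.1 hσ
  have hτ' : D.τ ^ (k : ℤ) = 1 := by rw [zpow_natCast]; exact orderOf_dvd_iff_pow_eq_one.1 hτ
  refine ⟨freeToSL_injective k hk, D.shearAction k hσ' hτ', D.isOrigamiAction_shearAction hσ' hτ',
    D.measurePreserving_shearAction hσ' hτ', D.toTorus_shearAction hσ' hτ',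
    fun g => D.isAffineWith_of_toTorus (D.toTorus_shearAction hσ' hτ' g),
    D.isFlatLipschitz_shearAction hσ' hτ', fun S hS => ?_⟩
  have hgap := D.hasSpectralGap_shearAction hσ' hτ' hk hS.2.2
  have hm : (D.m : ℝ≥0∞) ≠ 0 := Nat.cast_ne_zero.2 D.m_pos.ne'
  exact ⟨hgap.measureExpanding (D.measurePreserving_shearAction hσ' hτ') hS.1,
    hgap.smul_measure (ENNReal.inv_ne_zero.2 (ENNReal.natCast_ne_top _)) (ENNReal.inv_ne_top.2 hm)⟩
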